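/- **Conventions.** Boolean circuits have gates of fan-in at most two over $\{\wedge,\vee,\neg\}$ together with constants, and their size is the number of gates. A co-nondeterministic circuit $E$ on $n$ inputs is a circuit $E(x,y)$ with $x\in\{0,1\}^n$ and a nondeterministic input $y\in\{0,1\}^m$; $E(x)=1$ if $E(x,y)=1$ for all $y\in\{0,1\}^m$, and $E(x)=0$ otherwise; its size is $m$ plus the number of gates. $\mathsf{coNSIZE}[s(n)]$ is viewed as the class of co-nondeterministic circuits on $n$ inputs of size at most $s(n)$, each described by a bit string of fixed length $O(s(n)\log(n+s(n)))+O(\log n)$ that lists the number of nondeterministic inputs, the output wire and the gates with the binary numbers of the wires they read. $\mathsf{SAT}_n:\{0,1\}^n\to\{0,1\}$ is the satisfiability problem for De Morgan formulas (over $\wedge,\vee,\neg$ and variables) represented by $n$-bit strings: a formula is written in prefix notation, each symbol taking a block of two bits for its kind and $w$ bits, where $w=\lfloor\log_2 n\rfloor+1$ for $n\ge1$ ($w=0$ for $n=0$), for the binary number of a variable (zero for connectives), and is followed by arbitrary padding to length $n$; $\mathsf{SAT}_n(x)=1$ iff $x$ represents a satisfiable formula. A (nonuniform) refuter for $\mathsf{SAT}_n$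 against $\mathsf{coNSIZE}[s(n)]$ is a sequence $R=\{R_n\}$ of circuits, where $R_n$ takes as input the description of a co-nondeterministic circuit on $n$ inputs of size at most $s(n)$ and has $n$ output bits. It *succeeds* on input length $n$ if, for every co-nondeterministic circuit $E$ on $n$ inputs of size at most $s(n)$, the output $x=R_n(E)\in\{0,1\}^n$ satisfies $E(x)\neq\mathsf{SAT}_n(x)$. **Theorem.** The following results hold: (i) Let $k$ and $c$ be rational numbers such that $1<k<c<k^2$. Then there is no refuter $R=\{R_n\}$ for $\mathsf{SAT}_n$ against $\mathsf{coNSIZE}[n^k]$ such that, for every large enough $n$, $R_n$ has circuit size at most $n^c$ and succeeds on input length $n$. (ii) There is an integer $k\ge 1$ such that there is no refuter $R=\{R_n\}$ for $\mathsf{SAT}_n$ against $\mathsf{coNSIZE}[n^k]$ of polynomial circuit size (size at most $n^d$ for some constant $d$ and all large enough $n$) that succeeds on every large enough input length $n$. -/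

import Mathlib

/-- The `w` low-order binary digits of `a`, least significant digit first. -/
def bitsOf (w a : ℕ) : List Bool := (List.range w).map a.testBit

/-! ### Boolean circuits -/

/-- The gates of a circuit: fan-in at most two, over the De Morgan basis with constants.
The arguments are numbers of wires. -/
inductive BoolGate : Type
  | const (b : Bool) : BoolGate
  | not (a : ℕ) : BoolGate
  | and (a b : ℕ) : BoolGate
  | or (a b : ℕ) : BoolGate

namespace BoolGate

/-- All the wires read by the gate have a number smaller than `w`. -/
def Below (w : ℕ) : BoolGate → Prop
  | const _ => True
  | not a => a < w
  | and a b => a < w ∧ b < w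
  | or a b => a < w ∧ b < w

/-- The value of the gate when wire number `a` carries the bit `v a`. -/
def eval (v : ℕ → Bool) : BoolGate → Bool
  | const b => b
  | not a => !(v a)
  | and a b => v a && v b
  | or a b => v a || v b

/-- The description of a gate: three bits for the operation, then two wire numbers of `w` bits
each (unused positions are `0`). The operation code `000` belongs to no gate. -/
def code (w : ℕ) : BoolGate → List Bool
  | const b => [true, false, b] ++ bitsOf w 0 ++ bitsOf w 0
  | not a => [false, true, true] ++ bitsOf w a ++ bitsOf w 0
  | and a b => [false, false, true] ++ bitsOf w a ++ bitsOf w b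
  | or a b => [false, true, false] ++ bitsOf w a ++ bitsOf w b

end BoolGate

/-- Boolean circuits with `n` inputs and `p` outputs. The wires `0, …, n - 1` are the inputs,
wire `n + i` is the output of the `i`-th gate; a gate reads only earlier wires. -/
structure BoolCircuit (n p : ℕ) where
  gates : List BoolGate
  out : Fin p → ℕ
  gates_below : ∀ (i : ℕ) (h : i < gates.length), (gates[i]).Below (n + i)
  out_lt : ∀ j, out j < n + gates.length

namespace BoolCircuit

variable {n p : ℕ}

/-- The size of a circuit is its number of gates. -/
def size (C : BoolCircuit n p) : ℕ := C.gates.length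

/-- The bits on all the wires of the circuit, in order, on input `x`. -/
def wires (C : BoolCircuit n p) (x : Fin n → Bool) : List Bool :=
  C.gates.foldl (fun vs g => vs ++ [g.eval fun a => vs.getD a false]) (List.ofFn x)

/-- The output string of the circuit on input `x`. -/
def eval (C : BoolCircuit n p) (x : Fin n → Bool) : Fin p → Bool :=
  fun j => (C.wires x).getD (C.out j) false

end BoolCircuit

/-- Co-nondeterministic circuits on `n` inputs: a single-output circuit with `m` additional
nondeterministic inputs, which are the wires `n, …, n + m - 1`. -/
structure CoNondetCircuit (n : ℕ) where
  m : ℕ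
  circuit : BoolCircuit (n + m) 1

namespace CoNondetCircuit

variable {n : ℕ}

/-- The size of a co-nondeterministic circuit: nondeterministic inputs and gates. -/
def size (E : CoNondetCircuit n) : ℕ := E.m + E.circuit.size

/-- `E` accepts `x` (that is, `E(x) = 1`) if every nondeterministic string leads to output `1`. -/
def Accepts (E : CoNondetCircuit n) (x : Fin n → Bool) : Prop :=
  ∀ y : Fin E.m → Bool, E.circuit.eval (Fin.append x y) 0 = true

/-- The number of bits of a wire number in the description of a co-nondeterministic circuit
on `n` inputs of size at most `s` (such a circuit has at most `n + s` wires). -/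
def addrWidth (n s : ℕ) : ℕ := Nat.size (n + s)

/-- The length of the description of a co-nondeterministic circuit on `n` inputs of size at
most `s`. -/
def descLen (n s : ℕ) : ℕ := 2 * addrWidth n s + s * (3 + 2 * addrWidth n s)

/-- The description of a co-nondeterministic circuit of size at most `s`: the number of
nondeterministic inputs, the output wire and the list of all gates. -/
def code (s : ℕ) (E : CoNondetCircuit n) : List Bool :=
  bitsOf (addrWidth n s) E.m ++ bitsOf (addrWidth n s) (E.circuit.out 0) ++
    E.circuit.gates.flatMap (BoolGate.code (addrWidth n s))

/-- No description is longer than `descLen`. -/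
theorem length_code_le (s : ℕ) (E : CoNondetCircuit n) (h : E.size ≤ s) :
    (E.code s).length ≤ descLen n s := by
  have hb : ∀ w a : ℕ, (bitsOf w a).length = w := fun w a => by simp [bitsOf]
  have hg : ∀ (w : ℕ) (l : List BoolGate),
      (l.flatMap (BoolGate.code w)).length = l.length * (3 + 2 * w) := by
    intro w l
    induction l with
    | nil => simp
    | cons g l ih =>
      rw [List.flatMap_cons, List.length_append, ih, List.length_cons]
      cases g <;> simp [BoolGate.code, hb] <;> ring
  have hl : E.circuit.gates.length ≤ s := le_trans (Nat.le_add_left _ _) h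
  simp only [code, descLen, List.length_append, hb, hg]
  have := Nat.mul_le_mul_right (3 + 2 * addrWidth n s) hl
  omega

/-- The description of `E`, padded with zeros to length `descLen n s`. -/
def desc (s : ℕ) (E : CoNondetCircuit n) : Fin (descLen n s) → Bool :=
  fun i => (E.code s).getD i false

end CoNondetCircuit

/-! ### Satisfiability of De Morgan formulas -/

/-- De Morgan formulas over the variables `0, …, N - 1`. -/
inductive DMFormula (N : ℕ) : Type
  | var (i : Fin N) : DMFormula N
  | not (φ : DMFormula N) : DMFormula N
  | and (φ ψ : DMFormula N) : DMFormula N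
  | or (φ ψ : DMFormula N) : DMFormula N

namespace DMFormula

/-- The value of a formula under an assignment. -/
def eval {N : ℕ} (σ : Fin N → Bool) : DMFormula N → Bool
  | var i => σ i
  | not φ => !(φ.eval σ)
  | and φ ψ => φ.eval σ && ψ.eval σ
  | or φ ψ => φ.eval σ || ψ.eval σ

/-- Some assignment makes the formula true. -/
def Satisfiable {N : ℕ} (φ : DMFormula N) : Prop := ∃ σ : Fin N → Bool, φ.eval σ = true

/-- Polish (prefix) notation of a formula with variables numbered by `w` bits. Every symbol is a
block of two bits for its kind and `w` bits for the number of a variable (`0` for a connective). -/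
def code {w : ℕ} : DMFormula (2 ^ w) → List Bool
  | var i => [false, false] ++ bitsOf w i
  | not φ => [false, true] ++ bitsOf w 0 ++ φ.code
  | and φ ψ => [true, false] ++ bitsOf w 0 ++ (φ.code ++ ψ.code)
  | or φ ψ => [true, true] ++ bitsOf w 0 ++ (φ.code ++ ψ.code)

end DMFormula

/-- `SAT n x`: the string `x` of length `n` represents a satisfiable De Morgan formula.
The variables have numbers of `Nat.size n` binary digits (more variables cannot occur in a formula
of `n` bits); `x` represents `φ` if it consists of the notation of `φ` and some arbitrary
padding, which allows every length. The notation is prefix-free, so that `φ` is unique. -/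
def SAT (n : ℕ) (x : Fin n → Bool) : Prop :=
  ∃ φ : DMFormula (2 ^ Nat.size n), φ.code <+: List.ofFn x ∧ φ.Satisfiable

/-! ### Refuters -/

/-- The circuit `R`, which reads descriptions of co-nondeterministic circuits, succeeds as a refuter
for the language `L` on input length `n` against size `s`: for every co-nondeterministic circuit
`E` on `n` inputs of size at most `s`, it outputs a string `x` of length `n` with `E(x) ≠ L(x)`. -/
def Refutes (L : ∀ n : ℕ, (Fin n → Bool) → Prop) (n s : ℕ)
    (R : BoolCircuit (CoNondetCircuit.descLen n s) n) : Prop :=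
  ∀ E : CoNondetCircuit n, E.size ≤ s →
    ¬ (E.Accepts (R.eval (E.desc s)) ↔ L n (R.eval (E.desc s)))

/-! A refuter turns into a length-shrinking reduction of satisfiability to itself. For a string `x`
of length `n`, let `E_x` be the co-nondeterministic circuit on `l` inputs that ignores its input,
reads the nondeterministic bits as an assignment, and accepts iff that assignment does not satisfy
the formula of `x`. It accepts every input if `x` is not in SAT and none otherwise. If `R` refutes
on length `l` and `z = R(E_x)`, then `E_x(z) ≠ SAT(z)` says exactly that `x ∈ SAT` iff `z ∈ SAT`
(`exists_satSize_of_refutes`).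

Two facts make the reduction cheap. First, `E_x` has quasilinear size (`exists_unsat_circuit`).
Prefix notation is evaluated from right to left with a stack; the stack is simulated obliviously by
buffers whose blocks have size `2 ^ i` at level `i`, the buffer of level `i` being rebalanced once
per `2 ^ i` symbols, so that each level costs a linear number of gates and there are logarithmically
many levels (`LowStack.runCorrect`, `LowStack.exists_hasCost_run`). Second, the description of `E_x`
consists of constants and bits of `x` (`hasCost_desc_hardwired`): the variable field of a block of
`x` is copied into the wire number of a gate, so the lookup of variable values costs nothing.

Since `E_x` only has to fit into size `l ^ k`, one may take `l` about `n ^ α` with `α * k > 1`.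
Iterating gives circuits for SAT with about `n ^ (α * c)` gates (`exists_satSize_le`). When `c < k ^
2`, some such `α` has `α * c < k`, so SAT itself has circuits of size at most `n ^ k`; no string
refutes such a circuit (`SatSize.not_refutes`). For (ii), a polynomial refuter against size `n ^ 2`
puts SAT into polynomial size, which excludes refuters for a larger exponent. -/

/-! ### Gate complexity of functions between finite types of data -/

/-- `Derives I s T`: a straight-line program with at most `s` gates computes all the Boolean
functions in `T` from those in `I`. -/
inductive Derives {Ω : Type} (I : Set (Ω → Bool)) : ℕ → Set (Ω → Bool) → Prop
  | base : Derives I 0 I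
  | const {s : ℕ} {T : Set (Ω → Bool)} (b : Bool) (h : Derives I s T) :
      Derives I (s + 1) (insert (fun _ => b) T)
  | not {s : ℕ} {T : Set (Ω → Bool)} {f : Ω → Bool} (h : Derives I s T) (hf : f ∈ T) :
      Derives I (s + 1) (insert (fun ω => !f ω) T)
  | and {s : ℕ} {T : Set (Ω → Bool)} {f g : Ω → Bool} (h : Derives I s T) (hf : f ∈ T)
      (hg : g ∈ T) : Derives I (s + 1) (insert (fun ω => f ω && g ω) T)
  | or {s : ℕ} {T : Set (Ω → Bool)} {f g : Ω → Bool} (h : Derives I s T) (hf : f ∈ T)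
      (hg : g ∈ T) : Derives I (s + 1) (insert (fun ω => f ω || g ω) T)
  | weaken {s t : ℕ} {T U : Set (Ω → Bool)} (h : Derives I s T) (hs : s ≤ t) (hU : U ⊆ T) :
      Derives I t U

namespace Derives

variable {Ω Ω' : Type} {I J T U : Set (Ω → Bool)} {s t : ℕ}

theorem trans (h : Derives I s T) (h' : Derives T t U) : Derives I (s + t) U := by
  induction h' with
  | base => exact h
  | const b _ ih => exact ih.const b
  | not _ hf ih => exact ih.not hf
  | and _ hf hg ih => exact ih.and hf hg
  | or _ hf hg ih => exact ih.or hf hg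
  | weaken _ hs hU ih => exact ih.weaken (by omega) hU

theorem union_right (h : Derives I s T) (J : Set (Ω → Bool)) : Derives (I ∪ J) s (T ∪ J) := by
  induction h with
  | base => exact base
  | const b _ ih => rw [Set.insert_union]; exact ih.const b
  | not _ hf ih => rw [Set.insert_union]; exact ih.not (Or.inl hf)
  | and _ hf hg ih => rw [Set.insert_union]; exact ih.and (Or.inl hf) (Or.inl hg)
  | or _ hf hg ih => rw [Set.insert_union]; exact ih.or (Or.inl hf) (Or.inl hg)
  | weaken _ hs hU ih => exact ih.weaken hs (Set.union_subset_union_left _ hU)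

theorem precomp (h : Derives I s T) (v : Ω' → Ω) :
    Derives ((fun f => f ∘ v) '' I) s ((fun f => f ∘ v) '' T) := by
  induction h with
  | base => exact base
  | const b _ ih => rw [Set.image_insert_eq]; exact ih.const b
  | not _ hf ih => rw [Set.image_insert_eq]; exact ih.not (Set.mem_image_of_mem _ hf)
  | and _ hf hg ih =>
    rw [Set.image_insert_eq]
    exact ih.and (Set.mem_image_of_mem _ hf) (Set.mem_image_of_mem _ hg)
  | or _ hf hg ih =>
    rw [Set.image_insert_eq]
    exact ih.or (Set.mem_image_of_mem _ hf) (Set.mem_image_of_mem _ hg)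
  | weaken _ hs hU ih => exact ih.weaken hs (Set.image_mono hU)

theorem of_subset (h : T ⊆ I) : Derives I 0 T := base.weaken le_rfl h

theorem union (h : Derives I s T) (h' : Derives I t U) : Derives I (s + t) (T ∪ U) := by
  have h1 : Derives I s (I ∪ T) := by
    have := h.union_right I
    rwa [Set.union_self, Set.union_comm] at this
  have h2 := h'.union_right T
  rw [Set.union_comm U T] at h2
  exact h1.trans h2

/-- A finite set of functions can be derived if each of its members can. -/
theorem exists_of_finite (hT : T.Finite) (h : ∀ f ∈ T, ∃ s, Derives I s {f}) :
    ∃ s, Derives I s T := by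
  induction T, hT using Set.Finite.induction_on with
  | empty => exact ⟨0, of_subset (Set.empty_subset _)⟩
  | @insert a S _ _ ih =>
    obtain ⟨s, hs⟩ := h a (Set.mem_insert _ _)
    obtain ⟨t, ht⟩ := ih fun f hf => h f (Set.mem_insert_of_mem _ hf)
    exact ⟨s + t, hs.union ht⟩

theorem exists_all {κ : Type} (l : List κ) (F : κ → Ω → Bool)
    (h : ∀ i ∈ l, ∃ s, Derives I s {F i}) : ∃ s, Derives I s {fun ω => l.all fun i => F i ω} := by
  induction l with
  | nil => exact ⟨_, (base.const true).weaken le_rfl (by simp)⟩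
  | cons a l ih =>
    obtain ⟨s, hs⟩ := h a List.mem_cons_self
    obtain ⟨t, ht⟩ := ih fun i hi => h i (List.mem_cons_of_mem _ hi)
    exact ⟨_, ((hs.union ht).and (Or.inl rfl) (Or.inr rfl)).weaken le_rfl (by simp)⟩

theorem exists_any {κ : Type} (l : List κ) (F : κ → Ω → Bool)
    (h : ∀ i ∈ l, ∃ s, Derives I s {F i}) : ∃ s, Derives I s {fun ω => l.any fun i => F i ω} := by
  induction l with
  | nil => exact ⟨_, (base.const false).weaken le_rfl (by simp)⟩
  | cons a l ih =>
    obtain ⟨s, hs⟩ := h a List.mem_cons_self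
    obtain ⟨t, ht⟩ := ih fun i hi => h i (List.mem_cons_of_mem _ hi)
    exact ⟨_, ((hs.union ht).or (Or.inl rfl) (Or.inr rfl)).weaken le_rfl (by simp)⟩

end Derives

/-! ### Data carried by wires and the cost of functions between them -/

/-- A type of data carried by a bundle of wires: the wires carry the bits in `coords`, which
determine the datum. -/
class Wired (α : Type) where
  coords : Set (α → Bool)
  ext_coords : ∀ a b : α, (∀ c ∈ coords, c a = c b) → a = b

namespace Wired

instance : Wired Bool where
  coords := {id}
  ext_coords _ _ h := h id rfl

instance : Wired Unit where
  coords := ∅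
  ext_coords _ _ _ := rfl

instance {α β : Type} [Wired α] [Wired β] : Wired (α × β) where
  coords := (fun c => c ∘ Prod.fst) '' coords ∪ (fun c => c ∘ Prod.snd) '' coords
  ext_coords _ _ h := Prod.ext
    (ext_coords _ _ fun c hc => h _ (Or.inl ⟨c, hc, rfl⟩))
    (ext_coords _ _ fun c hc => h _ (Or.inr ⟨c, hc, rfl⟩))

instance {ι α : Type} [Wired α] : Wired (ι → α) where
  coords := ⋃ i, (fun c => c ∘ fun v => v i) '' coords
  ext_coords _ _ h := funext fun i =>
    ext_coords _ _ fun c hc => h _ (Set.mem_iUnion.2 ⟨i, c, hc, rfl⟩)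

/-- The redundant presentation of a datum by all of its Boolean properties. -/
abbrev full (α : Type) : Wired α where
  coords := Set.univ
  ext_coords a b h := by
    classical
    have := h (fun c => decide (c = a)) (Set.mem_univ _)
    simpa [eq_comm] using this

/-- Stack cells and counters are presented by all their properties, so that testing one of them
needs no gate (`HasCost.of_full`). -/
instance : Wired (Option Bool) := full _

instance (k : ℕ) : Wired (Fin k) := full _

end Wired

/-- `HasCost f s`: the function `f` is computed by a circuit with at most `s` gates. -/
def HasCost {α β : Type} [Wired α] [Wired β] (f : α → β) (s : ℕ) : Prop :=
  Derives Wired.coords s ((fun c => c ∘ f) '' Wired.coords)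

namespace HasCost

variable {α β γ δ : Type} [Wired α] [Wired β] [Wired γ] [Wired δ] {s t u : ℕ}

theorem mono {f : α → β} (h : HasCost f s) (hs : s ≤ t) : HasCost f t := h.weaken hs subset_rfl

theorem comp {g : β → γ} {f : α → β} (hg : HasCost g t) (hf : HasCost f s) :
    HasCost (fun a => g (f a)) (s + t) := by
  have := Derives.trans hf (hg.precomp f)
  rwa [Set.image_image] at this

theorem id : HasCost (fun a : α => a) 0 := Derives.of_subset (by
  rintro _ ⟨c, hc, rfl⟩; exact hc)

theorem fst : HasCost (Prod.fst : α × β → α) 0 := Derives.of_subset Set.subset_union_left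

theorem snd : HasCost (Prod.snd : α × β → β) 0 := Derives.of_subset Set.subset_union_right

theorem proj {ι : Type} (i : ι) : HasCost (fun v : ι → α => v i) 0 :=
  Derives.of_subset (Set.subset_iUnion_of_subset i subset_rfl)

theorem fst_of {f : α → β × γ} (h : HasCost f s) : HasCost (fun a => (f a).1) s := by
  simpa using fst.comp h

theorem snd_of {f : α → β × γ} (h : HasCost f s) : HasCost (fun a => (f a).2) s := by
  simpa using snd.comp h

theorem pair {f : α → β} {g : α → γ} (hf : HasCost f s) (hg : HasCost g t) :
    HasCost (fun a => (f a, g a)) (s + t) := by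
  have := Derives.union hf hg
  refine this.weaken le_rfl ?_
  rintro _ ⟨c, ⟨c, hc, rfl⟩ | ⟨c, hc, rfl⟩, rfl⟩
  · exact Or.inl ⟨c, hc, rfl⟩
  · exact Or.inr ⟨c, hc, rfl⟩

theorem const (b : β) : HasCost (fun _ : α => b) 2 := by
  refine ((Derives.base.const true).const false).weaken le_rfl ?_
  rintro _ ⟨c, -, rfl⟩
  cases h : c b
  · exact Or.inl (funext fun _ => h)
  · exact Or.inr (Or.inl (funext fun _ => h))

theorem reindex {ι κ : Type} (e : ι → κ) : HasCost (fun (v : κ → α) i => v (e i)) 0 :=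
  Derives.of_subset (by
    rintro _ ⟨_, hc', rfl⟩
    obtain ⟨i, c, hc, rfl⟩ := Set.mem_iUnion.1 hc'
    exact Set.mem_iUnion.2 ⟨e i, c, hc, rfl⟩)

/-- Every output bit is a constant or an input bit. -/
theorem of_literals {ι κ : Type} {f : (ι → Bool) → κ → Bool}
    (h : ∀ i, (∃ b, ∀ x, f x i = b) ∨ ∃ j, ∀ x, f x i = x j) : HasCost f 2 := by
  refine ((Derives.base.const true).const false).weaken le_rfl ?_
  rintro _ ⟨_, hc, rfl⟩
  obtain ⟨i, c, rfl, rfl⟩ := Set.mem_iUnion.1 hc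
  obtain ⟨b, hb⟩ | ⟨j, hj⟩ := h i
  · cases b
    · exact Or.inl (funext hb)
    · exact Or.inr (Or.inl (funext hb))
  · exact Or.inr (Or.inr (Set.mem_iUnion.2 ⟨j, _root_.id, rfl, funext fun x => (hj x).symm⟩))

theorem or {f g : α → Bool} (hf : HasCost f s) (hg : HasCost g t) :
    HasCost (fun a => f a || g a) (s + t + 1) :=
  ((Derives.union hf hg).or (f := f) (g := g) (Or.inl ⟨_, rfl, rfl⟩)
    (Or.inr ⟨_, rfl, rfl⟩)).weaken le_rfl (by rintro _ ⟨c, rfl, rfl⟩; exact Or.inl rfl)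

/-- A function with values in a redundantly presented type can be followed by any function. -/
theorem of_full {f : α → β} (hf : HasCost f s) (hβ : (Wired.coords : Set (β → Bool)) = Set.univ)
    (p : β → γ) : HasCost (fun a => p (f a)) s := by
  refine hf.weaken le_rfl ?_
  rintro _ ⟨c, -, rfl⟩
  exact ⟨c ∘ p, hβ ▸ Set.mem_univ _, rfl⟩

/-- Functions between finite types have some cost. -/
theorem exists_of_finite [Finite α] [Finite β] (f : α → β) : ∃ s, HasCost f s := by
  classical
  cases nonempty_fintype α
  refine Derives.exists_of_finite (Set.toFinite _) ?_
  rintro _ ⟨c, -, rfl⟩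
  let C : List (α → Bool) := (Set.toFinite (Wired.coords : Set (α → Bool))).toFinset.toList
  have hC : ∀ d, d ∈ C ↔ d ∈ (Wired.coords : Set (α → Bool)) := by simp [C]
  -- The minterm of `a`: since the coordinates determine the datum, it holds at `a` only, and the
  -- function is the disjunction of the minterms of the points where it is true.
  have hind : ∀ a : α, ∃ s, Derives (Wired.coords : Set (α → Bool)) s
      {fun ω => C.all fun d => (d ω == d a)} := by
    intro a
    refine Derives.exists_all C (fun d ω => (d ω == d a)) fun d hd => ?_
    rw [hC] at hd
    cases h : d a
    · exact ⟨_, (Derives.base.not hd).weaken le_rfl (by simp)⟩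
    · exact ⟨0, Derives.of_subset (by simpa using hd)⟩
  obtain ⟨s, hs⟩ := Derives.exists_any ((Finset.univ.filter fun a => c (f a) = true).toList)
    (fun a ω => C.all fun d => (d ω == d a)) fun a _ => hind a
  refine ⟨s, hs.weaken le_rfl ?_⟩
  rintro _ rfl
  refine funext fun ω => Bool.eq_iff_iff.2 ?_
  simp only [Function.comp, List.any_eq_true, List.all_eq_true, Finset.mem_toList,
    Finset.mem_filter, Finset.mem_univ, true_and, beq_iff_eq]
  constructor
  · exact fun h => ⟨ω, h, fun _ _ => rfl⟩
  · rintro ⟨a, ha, h⟩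
    rwa [Wired.ext_coords ω a fun d hd => h d ((hC d).2 hd)]

end HasCost

/-! ### Evaluation of prefix notation with a hierarchical stack -/

namespace HasCost

variable {α β γ : Type} [Wired α] [Wired β] [Wired γ]

/-- The circuits that select one of two data of type `β` have at most `w` gates. -/
def SelectCost (β : Type) [Wired β] (w : ℕ) : Prop :=
  HasCost (fun q : Bool × β × β => if q.1 then q.2.1 else q.2.2) w

theorem SelectCost.prod {v w : ℕ} (hβ : SelectCost β v) (hγ : SelectCost γ w) :
    SelectCost (β × γ) (v + w) := by
  have h1 : HasCost (fun q : Bool × (β × γ) × (β × γ) => (q.1, q.2.1.1, q.2.2.1)) 0 :=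
    fst.pair ((fst.comp (fst.comp snd)).pair (fst.comp (snd.comp snd)))
  have h2 : HasCost (fun q : Bool × (β × γ) × (β × γ) => (q.1, q.2.1.2, q.2.2.2)) 0 :=
    fst.pair ((snd.comp (fst.comp snd)).pair (snd.comp (snd.comp snd)))
  have h3 := (hβ.comp h1).pair (hγ.comp h2)
  refine cast (congrArg₂ HasCost ?_ (by omega)) h3
  funext q
  obtain ⟨_ | _, x, y⟩ := q <;> rfl

/-- Choice between two data according to a property of a redundantly presented one. -/
theorem select {w s t u : ℕ} (hβ : SelectCost β w) {k : α → γ}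
    (hγ : (Wired.coords : Set (γ → Bool)) = Set.univ) (hk : HasCost k s) (p : γ → Prop)
    [DecidablePred p] {f g : α → β} (hf : HasCost f t) (hg : HasCost g u) :
    HasCost (fun a => if p (k a) then f a else g a) (s + (t + u) + w) := by
  have := HasCost.comp hβ ((HasCost.of_full hk hγ fun c => decide (p c)).pair (hf.pair hg))
  simpa using this

end HasCost

/-! ### Perfect trees of data -/

/-- Perfect binary trees of height `j` with leaves in `α`. -/
def PerfTree (α : Type) : ℕ → Type
  | 0 => α
  | j + 1 => PerfTree α j × PerfTree α j

namespace PerfTree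

variable {α : Type}

/-- The wires of a tree are those of its leaves. -/
@[reducible] def wiredAux [Wired α] : ∀ j, Wired (PerfTree α j)
  | 0 => inferInstanceAs (Wired α)
  | j + 1 =>
    letI := wiredAux j
    inferInstanceAs (Wired (PerfTree α j × PerfTree α j))

instance [Wired α] (j : ℕ) : Wired (PerfTree α j) := wiredAux j

/-- The leaves from left to right. -/
def leaves : ∀ j, PerfTree α j → List α
  | 0, a => [a]
  | j + 1, t => leaves j t.1 ++ leaves j t.2

/-- The tree with leaves `f 0, …, f (2 ^ j - 1)`. -/
def ofFun : ∀ j, (ℕ → α) → PerfTree α j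
  | 0, f => f 0
  | j + 1, f => (ofFun j f, ofFun j fun p => f (2 ^ j + p))

theorem leaves_ofFun (j : ℕ) (f : ℕ → α) : leaves j (ofFun j f) = (List.range (2 ^ j)).map f := by
  induction j generalizing f with
  | zero => simp [leaves, ofFun]
  | succ j ih =>
    simp only [leaves, ofFun, ih]
    rw [pow_succ, mul_two, List.range_add, List.map_append, List.map_map]
    rfl

theorem hasCost_ofFun {Ω : Type} [Wired Ω] [Wired α] {s : ℕ} (j : ℕ) (f : Ω → ℕ → α)
    (h : ∀ p < 2 ^ j, HasCost (fun ω => f ω p) s) :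
    HasCost (fun ω => ofFun j (f ω)) (2 ^ j * s) := by
  induction j generalizing f with
  | zero => exact (h 0 (by simp)).mono (by simp)
  | succ j ih =>
    have h1 := ih f fun p hp => h p (by rw [pow_succ]; omega)
    have h2 := ih (fun ω p => f ω (2 ^ j + p)) fun p hp => h _ (by rw [pow_succ]; omega)
    exact HasCost.mono (s := 2 ^ j * s + 2 ^ j * s) (h1.pair h2) (by rw [pow_succ]; linarith)

theorem selectCost [Wired α] {w : ℕ} (h : HasCost.SelectCost α w) (j : ℕ) :
    HasCost.SelectCost (PerfTree α j) (2 ^ j * w) := by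
  induction j with
  | zero => exact HasCost.mono h (by simp)
  | succ j ih =>
    have := ih.prod ih
    rw [← two_mul, ← mul_assoc, ← pow_succ'] at this
    exact this

end PerfTree

/-! ### Symbols acting on a stack, and buffers of at most five blocks -/

/-- The entries of the evaluation stack; `none` means that there is no well-formed subformula. -/
abbrev StackCell := Option Bool

/-- The symbols of prefix notation, the variables replaced by their values. -/
inductive Token : Type
  | leaf (c : StackCell)
  | not
  | and
  | or

namespace Token

instance : Wired Token := Wired.full _

instance : Finite Token :=
  Finite.of_injective
    (fun t : Token => match t with
      | leaf c => (Sum.inl c : StackCell ⊕ Fin 3)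
      | not => Sum.inr 0
      | and => Sum.inr 1
      | or => Sum.inr 2)
    (by rintro (_ | _ | _ | _) (_ | _ | _ | _) h <;> simp_all)

/-- The effect of a symbol on the stack, when prefix notation is read from right to left. -/
def step : Token → List StackCell → List StackCell
  | leaf c, l => c :: l
  | not, l => (l.getD 0 none).map Bool.not :: l.drop 1
  | and, l => Option.map₂ Bool.and (l.getD 0 none) (l.getD 1 none) :: l.drop 2
  | or, l => Option.map₂ Bool.or (l.getD 0 none) (l.getD 1 none) :: l.drop 2

end Token

/-- Buffers holding up to five blocks: the number of blocks in use, and the blocks. -/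
abbrev StackBuffer (β : Type) := Fin 6 × β × β × β × β × β

namespace StackBuffer

variable {β : Type}

/-- The blocks in use. -/
def toList (b : StackBuffer β) : List β :=
  [b.2.1, b.2.2.1, b.2.2.2.1, b.2.2.2.2.1, b.2.2.2.2.2].take b.1

/-- Pushing to or popping from the top of the stack. -/
def step (q : Token × StackBuffer StackCell) : StackBuffer StackCell :=
  match q with
  | (.leaf c, n, b0, b1, b2, b3, _) => (n + 1, c, b0, b1, b2, b3)
  | (.not, n, b0, b1, b2, b3, b4) => (n, b0.map Bool.not, b1, b2, b3, b4)
  | (.and, n, b0, b1, b2, b3, b4) => (n - 1, Option.map₂ Bool.and b0 b1, b2, b3, b4, b4)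
  | (.or, n, b0, b1, b2, b3, b4) => (n - 1, Option.map₂ Bool.or b0 b1, b2, b3, b4, b4)

/-- Two blocks are enough for the operands of a binary connective, and three leave room for a push,
so the part of the stack below the buffer is not touched. -/
theorem toList_step (t : Token) (b : StackBuffer StackCell) (hb : b.1 = 2 ∨ b.1 = 3)
    (l : List StackCell) : (step (t, b)).toList ++ l = t.step (b.toList ++ l) := by
  obtain ⟨n, b0, b1, b2, b3, b4⟩ := b
  obtain rfl | rfl : n = 2 ∨ n = 3 := hb <;> cases t <;> rfl

/-- Moves a double block between a buffer and the next one, so that the first one holds two or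
three blocks. -/
def balance (q : StackBuffer β × StackBuffer (β × β)) : StackBuffer β × StackBuffer (β × β) :=
  let b := q.1
  let B := q.2
  ((if b.1 ≤ 1 then b.1 + 2 else if b.1 ≤ 3 then b.1 else b.1 - 2,
    if b.1 = 0 then B.2.1.1 else b.2.1,
    if b.1 = 0 then B.2.1.2 else if b.1 = 1 then B.2.1.1 else b.2.2.1,
    if b.1 = 1 then B.2.1.2 else b.2.2.2.1,
    b.2.2.2.2.1, b.2.2.2.2.2),
   (if b.1 ≤ 1 then B.1 - 1 else if b.1 ≤ 3 then B.1 else B.1 + 1,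
    if b.1 ≤ 1 then B.2.2.1 else if b.1 ≤ 3 then B.2.1 else
      if b.1 = 4 then (b.2.2.2.1, b.2.2.2.2.1) else (b.2.2.2.2.1, b.2.2.2.2.2),
    if b.1 ≤ 1 then B.2.2.2.1 else if b.1 ≤ 3 then B.2.2.1 else B.2.1,
    if b.1 ≤ 1 then B.2.2.2.2.1 else if b.1 ≤ 3 then B.2.2.2.1 else B.2.2.1,
    if b.1 ≤ 1 then B.2.2.2.2.2 else if b.1 ≤ 3 then B.2.2.2.2.1 else B.2.2.2.1,
    if b.1 ≤ 3 then B.2.2.2.2.2 else B.2.2.2.2.1))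

theorem balance_count (b : StackBuffer β) (B : StackBuffer (β × β)) :
    (balance (b, B)).1.1 = 2 ∨ (balance (b, B)).1.1 = 3 := by
  obtain ⟨n, b⟩ := b
  fin_cases n <;> simp [balance] 

/-- The bounds on `B.1` keep the arithmetic in `Fin 6` from wrapping around: there is a double block
to fetch and room for one more. -/
theorem balance_count_snd (b : StackBuffer β) (B : StackBuffer (β × β)) (h1 : 1 ≤ (B.1 : ℕ))
    (h4 : (B.1 : ℕ) ≤ 4) : ((balance (b, B)).2.1 : ℕ) ≤ B.1 + 1 ∧
      (B.1 : ℕ) ≤ (balance (b, B)).2.1 + 1 := by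
  obtain ⟨n, b⟩ := b
  obtain ⟨N, B⟩ := B
  revert h1 h4
  have key : ∀ n N : Fin 6, 1 ≤ (N : ℕ) → (N : ℕ) ≤ 4 →
    ((if n ≤ 1 then N - 1 else if n ≤ 3 then N else N + 1 : Fin 6) : ℕ) ≤ N + 1 ∧
    (N : ℕ) ≤ (if n ≤ 1 then N - 1 else if n ≤ 3 then N else N + 1 : Fin 6) + 1 := by decide
  exact key n N

/-- Balancing only moves the boundary between two adjacent buffers; a double block is read as its
two halves, and the concatenated contents stay the same. -/
theorem balance_toList {γ : Type} (f : β → List γ) (b : StackBuffer β) (B : StackBuffer (β × β))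
    (h1 : 1 ≤ (B.1 : ℕ)) (h4 : (B.1 : ℕ) ≤ 4) :
    (balance (b, B)).1.toList.flatMap f ++
        (balance (b, B)).2.toList.flatMap (fun p => f p.1 ++ f p.2) =
      b.toList.flatMap f ++ B.toList.flatMap fun p => f p.1 ++ f p.2 := by
  obtain ⟨n, b0, b1, b2, b3, b4⟩ := b
  obtain ⟨N, B0, B1, B2, B3, B4⟩ := B
  obtain rfl | rfl | rfl | rfl : N = 1 ∨ N = 2 ∨ N = 3 ∨ N = 4 := by
    have key : ∀ N : Fin 6, 1 ≤ (N : ℕ) → (N : ℕ) ≤ 4 → N = 1 ∨ N = 2 ∨ N = 3 ∨ N = 4 := by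
      decide
    exact key N h1 h4
  all_goals fin_cases n <;> simp [balance, toList]

/-- The control depends only on the two counters, and every block of the result is selected among
boundedly many blocks. The constant does not depend on the type of the blocks, as is needed for use
at all levels. -/
theorem exists_hasCost_balance : ∃ K : ℕ, ∀ (β : Type) [Wired β] (w : ℕ),
    HasCost.SelectCost β w →
      HasCost (balance : StackBuffer β × StackBuffer (β × β) → _) (K * w + K) := by
  obtain ⟨K, hK⟩ := HasCost.exists_of_finite fun p : Fin 6 × Fin 6 =>
    if p.1 ≤ 1 then p.2 - 1 else if p.1 ≤ 3 then p.2 else p.2 + 1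
  -- Four selections of blocks and ten of double blocks cost `24 * w` gates; the new second counter
  -- costs `K`.
  refine ⟨K + 30, fun β _ w hw => ?_⟩
  have hw2 := hw.prod hw
  have hfull : (Wired.coords : Set (Fin 6 → Bool)) = Set.univ := rfl
  have b : HasCost (fun q : StackBuffer β × StackBuffer (β × β) => q.1) 0 := .fst
  have B : HasCost (fun q : StackBuffer β × StackBuffer (β × β) => q.2) 0 := .snd
  have n := b.fst_of
  have b0 := b.snd_of.fst_of
  have b1 := b.snd_of.snd_of.fst_of
  have b2 := b.snd_of.snd_of.snd_of.fst_of
  have b3 := b.snd_of.snd_of.snd_of.snd_of.fst_of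
  have b4 := b.snd_of.snd_of.snd_of.snd_of.snd_of
  have N := B.fst_of
  have B0 := B.snd_of.fst_of
  have B1 := B.snd_of.snd_of.fst_of
  have B2 := B.snd_of.snd_of.snd_of.fst_of
  have B3 := B.snd_of.snd_of.snd_of.snd_of.fst_of
  have B4 := B.snd_of.snd_of.snd_of.snd_of.snd_of
  have sel := fun p [DecidablePred p] {s t} {f g : StackBuffer β × StackBuffer (β × β) → β}
    (hf : HasCost f s) (hg : HasCost g t) => HasCost.select hw hfull n p hf hg
  have sel2 := fun p [DecidablePred p] {s t} {f g : StackBuffer β × StackBuffer (β × β) → β × β}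
    (hf : HasCost f s) (hg : HasCost g t) => HasCost.select hw2 hfull n p hf hg
  refine HasCost.mono (HasCost.pair
    ((HasCost.of_full n hfull fun n => if n ≤ 1 then n + 2 else if n ≤ 3 then n else n - 2).pair
      ((sel (· = 0) B0.fst_of b0).pair
      ((sel (· = 0) B0.snd_of (sel (· = 1) B0.fst_of b1)).pair
      ((sel (· = 1) B0.snd_of b2).pair (b3.pair b4)))))
    ((hK.comp (n.pair N)).pair
      ((sel2 (· ≤ 1) B1 (sel2 (· ≤ 3) B0 (sel2 (· = 4) (b2.pair b3) (b3.pair b4)))).pair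
      ((sel2 (· ≤ 1) B2 (sel2 (· ≤ 3) B1 B0)).pair
      ((sel2 (· ≤ 1) B3 (sel2 (· ≤ 3) B2 B1)).pair
      ((sel2 (· ≤ 1) B4 (sel2 (· ≤ 3) B3 B2)).pair (sel2 (· ≤ 3) B4 B3))))))) ?_
  nlinarith [Nat.zero_le (K * w)]

end StackBuffer

/-! ### The hierarchical stack and its cost -/

/-- The part of the stack kept in the buffers of the levels below `j`; the buffer of level `i`
holds blocks of `2 ^ i` entries. -/
def LowStack : ℕ → Type
  | 0 => Unit
  | j + 1 => LowStack j × StackBuffer (PerfTree StackCell j)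

namespace LowStack

/-- The wires of the buffers. -/
@[reducible] def wiredAux : ∀ j, Wired (LowStack j)
  | 0 => inferInstanceAs (Wired Unit)
  | j + 1 =>
    letI := wiredAux j
    inferInstanceAs (Wired (LowStack j × StackBuffer (PerfTree StackCell j)))

instance (j : ℕ) : Wired (LowStack j) := wiredAux j

/-- The entries of a buffer, from top to bottom. -/
def entries (j : ℕ) (b : StackBuffer (PerfTree StackCell j)) : List StackCell :=
  b.toList.flatMap (PerfTree.leaves j)

/-- The stack represented by the buffers, from top to bottom. -/
def toList : ∀ j, LowStack j → List StackCell
  | 0, _ => []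
  | j + 1, l => toList j l.1 ++ entries j l.2

/-- All the buffers hold two or three blocks. -/
def Balanced : ∀ j, LowStack j → Prop
  | 0, _ => True
  | j + 1, l => Balanced j l.1 ∧ (l.2.1 = 2 ∨ l.2.1 = 3)

/-- The buffers filled with two blocks of `none` each. -/
def initial : ∀ j, LowStack j
  | 0 => ()
  | j + 1 =>
    let t : PerfTree StackCell j := PerfTree.ofFun j fun _ => none
    (initial j, 2, t, t, t, t, t)

theorem balanced_initial : ∀ j, Balanced j (initial j)
  | 0 => trivial
  | j + 1 => ⟨balanced_initial j, Or.inl rfl⟩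

theorem toList_initial : ∀ j, ∀ c ∈ toList j (initial j), c = none
  | 0 => by simp [toList]
  | j + 1 => by
    intro c hc
    rcases List.mem_append.1 hc with hc | hc
    · exact toList_initial j c hc
    · have : ∀ c ∈ PerfTree.leaves j (PerfTree.ofFun j fun _ => (none : StackCell)), c = none := by
        rw [PerfTree.leaves_ofFun]; simp
      simp only [initial, entries, StackBuffer.toList, List.mem_flatMap] at hc
      obtain ⟨t, ht, hc⟩ := hc
      have ht := List.mem_of_mem_take ht
      simp only [List.mem_cons, List.not_mem_nil, or_false, or_self] at ht
      exact this c (ht ▸ hc)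

/-- The topmost entry. -/
def top : ∀ j, LowStack (j + 1) → StackCell
  | 0, l => l.2.2.1
  | j + 1, l => top j l.1

theorem head_toList : ∀ j (l : LowStack (j + 1)), Balanced (j + 1) l →
    (toList (j + 1) l).head? = some (top j l)
  | 0, ⟨_, n, b⟩, ⟨_, h⟩ => by
    obtain rfl | rfl : n = 2 ∨ n = 3 := h <;> rfl
  | j + 1, l, h => by
    rw [toList, List.head?_append, head_toList j l.1 h.1]
    rfl

theorem hasCost_top : ∀ j, HasCost (top j) 0
  | 0 => HasCost.fst.comp (HasCost.snd.comp HasCost.snd)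
  | j + 1 => (hasCost_top j).comp HasCost.fst

/-- A computation on the buffers up to level `j`, followed by balancing the buffer of level `j`. -/
def thenBalance {j : ℕ} (f : PerfTree Token j × LowStack j × StackBuffer (PerfTree StackCell j) →
      LowStack j × StackBuffer (PerfTree StackCell j))
    (r : PerfTree Token j × LowStack (j + 1) × StackBuffer (PerfTree StackCell (j + 1))) :
    LowStack (j + 1) × StackBuffer (PerfTree StackCell (j + 1)) :=
  let l := f (r.1, r.2.1)
  let b := StackBuffer.balance (l.2, r.2.2)
  ((l.1, b.1), b.2)

/-- The effect of the symbols at the leaves of a tree, from right to left. -/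
def run : ∀ j, PerfTree Token j × LowStack j × StackBuffer (PerfTree StackCell j) →
    LowStack j × StackBuffer (PerfTree StackCell j)
  | 0, q => (q.2.1, StackBuffer.step (q.1, q.2.2))
  | j + 1, q => thenBalance (run j) (q.1.1, thenBalance (run j) (q.1.2, q.2))

/-- The properties of `run j`: the buffer of level `j` changes by at most two blocks. -/
def RunCorrect (j : ℕ) : Prop :=
  ∀ (t : PerfTree Token j) (l : LowStack j) (b : StackBuffer (PerfTree StackCell j))
    (rest : List StackCell), Balanced j l → (b.1 = 2 ∨ b.1 = 3) →
    Balanced j (run j (t, l, b)).1 ∧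
    ((run j (t, l, b)).2.1 : ℕ) ≤ b.1 + 2 ∧ (b.1 : ℕ) ≤ (run j (t, l, b)).2.1 + 2 ∧
    toList j (run j (t, l, b)).1 ++ entries j (run j (t, l, b)).2 ++ rest =
      (PerfTree.leaves j t).foldr Token.step (toList j l ++ entries j b ++ rest)

/-- A run at level `j` changes the buffer of that level, which starts with two or three blocks, by
at most two, so its count stays between 0 and 5. One double block moved to or from the next level
then restores balance; hence the next buffer changes by at most one. -/
theorem RunCorrect.thenBalance {j : ℕ} (h : RunCorrect j) (t : PerfTree Token j)
    (l : LowStack (j + 1)) (b : StackBuffer (PerfTree StackCell (j + 1))) (rest : List StackCell)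
    (hl : Balanced (j + 1) l) (h1 : 1 ≤ (b.1 : ℕ)) (h4 : (b.1 : ℕ) ≤ 4)
    {l' : LowStack (j + 1)} {b' : StackBuffer (PerfTree StackCell (j + 1))}
    (hr : thenBalance (run j) (t, l, b) = (l', b')) :
    Balanced (j + 1) l' ∧ (b'.1 : ℕ) ≤ b.1 + 1 ∧ (b.1 : ℕ) ≤ b'.1 + 1 ∧
    toList (j + 1) l' ++ entries (j + 1) b' ++ rest =
      (PerfTree.leaves j t).foldr Token.step (toList (j + 1) l ++ entries (j + 1) b ++ rest) := by
  obtain ⟨l, B⟩ := l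
  obtain ⟨h1', -, -, h4'⟩ := h t l B (entries (j + 1) b ++ rest) hl.1 hl.2
  have hb := StackBuffer.balance_count_snd (run j (t, l, B)).2 b h1 h4
  have hs := StackBuffer.balance_toList (PerfTree.leaves j) (run j (t, l, B)).2 b h1 h4
  obtain ⟨rfl, rfl⟩ := Prod.mk.inj hr
  refine ⟨⟨h1', StackBuffer.balance_count _ _⟩, hb.1, hb.2, ?_⟩
  have e : ∀ x y z y' z' v w : List StackCell, y' ++ z' = y ++ z → x ++ y ++ (z ++ v) = w →
      x ++ y' ++ z' ++ v = w := by
    intro x y z y' z' v w h h'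
    rw [← h', List.append_assoc x, h]
    simp
  refine e _ _ _ _ _ _ _ hs (h4'.trans ?_)
  rw [← List.append_assoc]
  rfl

/-- Each half of a run changes the buffer of the next level by at most one block. From two or three
blocks it has between one and four after the first half, which is what the second half requires, and
the total change is at most two. -/
theorem runCorrect (j : ℕ) : RunCorrect j := by
  induction j with
  | zero =>
    intro t l b rest _ hb
    have e : ∀ b : StackBuffer StackCell, entries 0 b = b.toList := fun b =>
      List.flatMap_singleton' _
    refine ⟨trivial, ?_, ?_, ?_⟩
    · obtain ⟨n, b⟩ := b
      obtain rfl | rfl : n = 2 ∨ n = 3 := hb <;> rcases t with _ | _ | _ | _ <;>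
        simp [run, StackBuffer.step]
    · obtain ⟨n, b⟩ := b
      obtain rfl | rfl : n = 2 ∨ n = 3 := hb <;> rcases t with _ | _ | _ | _ <;>
        simp [run, StackBuffer.step]
    · have := StackBuffer.toList_step t b hb rest
      exact (congrArg (· ++ rest) (e _)).trans (this.trans (congrArg (fun l => t.step (l ++ rest))
        (e b).symm))
  | succ j ih =>
    intro t l b rest hl hb
    have hb' : 2 ≤ (b.1 : ℕ) ∧ (b.1 : ℕ) ≤ 3 := by rcases hb with hb | hb <;> simp [hb]
    rcases h2 : thenBalance (run j) (t.2, l, b) with ⟨l2, b2⟩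
    obtain ⟨a1, a2, a3, a4⟩ := ih.thenBalance t.2 l b rest hl (by omega) (by omega) h2
    rcases h3 : thenBalance (run j) (t.1, l2, b2) with ⟨l3, b3⟩
    obtain ⟨c1, c2, c3, c4⟩ := ih.thenBalance t.1 l2 b2 rest a1 (by omega) (by omega) h3
    have hr : run (j + 1) (t, l, b) = (l3, b3) := by rw [← h3, ← h2]; rfl
    rw [hr]
    refine ⟨c1, (by omega : (b3.1 : ℕ) ≤ b.1 + 2), (by omega : (b.1 : ℕ) ≤ b3.1 + 2), ?_⟩
    rw [PerfTree.leaves, List.foldr_append, ← a4, ← c4]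

/-- The recursion is `T (j + 1) = 2 * (T j + O(2 ^ j))`: two half runs, each followed by one
balancing of blocks with `2 ^ j` entries. Every level thus contributes a linear number of gates. -/
theorem exists_hasCost_run : ∃ K : ℕ, ∀ j, HasCost (run j) (K * 2 ^ j * (j + 1)) := by
  obtain ⟨K₀, hK₀⟩ := HasCost.exists_of_finite StackBuffer.step
  obtain ⟨K₁, hK₁⟩ := StackBuffer.exists_hasCost_balance
  obtain ⟨K₂, hK₂⟩ := HasCost.exists_of_finite
    fun q : Bool × StackCell × StackCell => if q.1 then q.2.1 else q.2.2
  refine ⟨K₀ + K₁ * K₂ + K₁, fun j => ?_⟩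
  induction j with
  | zero =>
    have : HasCost (run 0) (0 + (0 + K₀)) :=
      (HasCost.fst.comp HasCost.snd).pair
        (hK₀.comp (HasCost.fst.pair (HasCost.snd.comp HasCost.snd)))
    exact this.mono (by simp; omega)
  | succ j ih =>
    have hb := hK₁ _ _ (PerfTree.selectCost hK₂ j)
    have hhalf : HasCost (thenBalance (run j)) (0 + (K₀ + K₁ * K₂ + K₁) * 2 ^ j * (j + 1) +
        (K₁ * (2 ^ j * K₂) + K₁)) := by
      have h1 := (ih.comp (HasCost.fst.pair (HasCost.fst.comp HasCost.snd) : HasCost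
        (fun r : PerfTree Token j × (LowStack j × StackBuffer (PerfTree StackCell j)) ×
          StackBuffer (PerfTree StackCell (j + 1)) => (r.1, r.2.1)) _)).pair
        (HasCost.snd.comp HasCost.snd)
      have h2 := HasCost.fst.comp HasCost.fst |>.pair (hb.comp
        ((HasCost.snd.comp HasCost.fst : HasCost
          (fun r : (LowStack j × StackBuffer (PerfTree StackCell j)) ×
            StackBuffer (PerfTree StackCell j × PerfTree StackCell j) => r.1.2) _).pair
          HasCost.snd))
      have h3 : HasCost (fun r : LowStack j × StackBuffer (PerfTree StackCell j) ×
          StackBuffer (PerfTree StackCell j × PerfTree StackCell j) => ((r.1, r.2.1), r.2.2)) 0 :=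
        (HasCost.fst.pair (HasCost.fst.comp HasCost.snd)).pair (HasCost.snd.comp HasCost.snd)
      exact (h3.comp (h2.comp h1)).mono (by omega)
    let Q := (PerfTree Token j × PerfTree Token j) × LowStack (j + 1) ×
      StackBuffer (PerfTree StackCell (j + 1))
    have h1 : HasCost (fun q : Q => q.1.1) 0 := HasCost.fst.comp HasCost.fst
    have h2 : HasCost (fun q : Q => q.1.2) 0 := HasCost.snd.comp HasCost.fst
    have h3 : HasCost (fun q : Q => q.2) 0 := HasCost.snd
    have h : HasCost (run (j + 1)) _ := hhalf.comp (h1.pair (hhalf.comp (h2.pair h3)))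
    refine h.mono ?_
    have := Nat.one_le_two_pow (n := j)
    rw [pow_succ]
    nlinarith [Nat.zero_le (K₁ * K₂ * 2 ^ j), Nat.zero_le (K₀ * 2 ^ j), Nat.mul_le_mul_left K₁ this]

end LowStack

/-! ### The stack recognizes satisfied formulas -/

theorem length_bitsOf (w a : ℕ) : (bitsOf w a).length = w := by simp [bitsOf]

/-- The variable number in the block of bits at the head of `l`. -/
def blockVar (w : ℕ) (l : List Bool) : Fin (2 ^ w) :=
  ⟨Nat.ofBits fun i : Fin w => l.getD (2 + i) false, Nat.ofBits_lt_two_pow _⟩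

/-- The symbol with the given bits for its kind; `z` tells whether its number field is nonzero,
`b` whether the block is complete, and `u` is the value of the variable. -/
def tokenOf (q : Bool × Bool × Bool × Bool × Bool) : Token :=
  match q with
  | (_, _, _, false, _) => .leaf none
  | (false, false, _, true, u) => .leaf (some u)
  | (_, _, true, true, _) => .leaf none
  | (false, true, false, true, _) => .not
  | (true, false, false, true, _) => .and
  | (true, true, false, true, _) => .or

/-- The symbol at the head of `l`, with the value `u` for a variable. -/
def headToken (w : ℕ) (l : List Bool) (u : Bool) : Token :=
  tokenOf (l.getD 0 false, l.getD 1 false, (List.range w).any fun i => l.getD (2 + i) false,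
    decide (w + 2 ≤ l.length), u)

/-- The first `q` symbols of `l` under an assignment. -/
def tokens (w : ℕ) (σ : Fin (2 ^ w) → Bool) : ℕ → List Bool → List Token
  | 0, _ => []
  | q + 1, l => headToken w l (σ (blockVar w l)) :: tokens w σ q (l.drop (w + 2))

theorem tokens_eq_map (w : ℕ) (σ : Fin (2 ^ w) → Bool) (q : ℕ) (l : List Bool) :
    tokens w σ q l = (List.range q).map fun p =>
      headToken w (l.drop (p * (w + 2))) (σ (blockVar w (l.drop (p * (w + 2))))) := by
  induction q generalizing l with
  | zero => rfl
  | succ q ih =>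
    rw [tokens, ih, List.range_succ_eq_map, List.map_cons, List.map_map]
    congr 1
    · simp
    · refine List.map_congr_left fun p _ => ?_
      simp only [Function.comp, List.drop_drop, Nat.succ_eq_add_one, add_mul, one_mul, add_comm]

theorem bitsOf_ofBits {w : ℕ} (l : List Bool) (hl : w + 2 ≤ l.length) :
    bitsOf w (blockVar w l) = (l.drop 2).take w := by
  refine List.ext_getElem (by simp [length_bitsOf]; omega) fun i h1 h2 => ?_
  rw [length_bitsOf] at h1
  simp only [bitsOf, blockVar, List.getElem_map, List.getElem_range, List.getElem_take,
    List.getElem_drop]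
  rw [Nat.testBit_ofBits_lt _ _ h1, List.getD_eq_getElem]

theorem block_eq {w : ℕ} (l : List Bool) (hl : w + 2 ≤ l.length) :
    l = [l.getD 0 false, l.getD 1 false] ++ (l.drop 2).take w ++ l.drop (w + 2) := by
  match l, hl with
  | a :: b :: l, _ => simp

theorem bitsOf_zero (w : ℕ) : bitsOf w 0 = List.replicate w false := by
  simp [bitsOf, List.eq_replicate_iff]

theorem take_eq_bitsOf_zero {w : ℕ} (l : List Bool) (hl : w + 2 ≤ l.length)
    (h : ((List.range w).any fun i => l.getD (2 + i) false) = false) :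
    (l.drop 2).take w = bitsOf w 0 := by
  rw [bitsOf_zero, List.eq_replicate_iff]
  refine ⟨by simp; omega, fun b hb => ?_⟩
  obtain ⟨i, hi, rfl⟩ := List.getElem_of_mem hb
  simp only [List.any_eq_false, List.mem_range] at h
  simp only [List.length_take, List.length_drop] at hi
  have := h i (by omega)
  rw [List.getD_eq_getElem _ _ (by omega)] at this
  simpa using this

/-- The blocks of the four kinds of symbols. -/
theorem headToken_cases {w : ℕ} (l : List Bool) (u : Bool) :
    headToken w l u = .leaf none ∨
    (headToken w l u = .leaf (some u) ∧
      l = [false, false] ++ bitsOf w (blockVar w l) ++ l.drop (w + 2)) ∨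
    (headToken w l u = .not ∧ l = [false, true] ++ bitsOf w 0 ++ l.drop (w + 2)) ∨
    (headToken w l u = .and ∧ l = [true, false] ++ bitsOf w 0 ++ l.drop (w + 2)) ∨
    (headToken w l u = .or ∧ l = [true, true] ++ bitsOf w 0 ++ l.drop (w + 2)) := by
  by_cases hl : w + 2 ≤ l.length
  swap
  · left
    simp [headToken, tokenOf, hl]
  have h := block_eq l hl
  unfold headToken
  cases h0 : l.getD 0 false <;> cases h1 : l.getD 1 false <;>
    cases hz : (List.range w).any fun i => l.getD (2 + i) false <;>
    rw [h0, h1] at h <;> simp only [hl, decide_true, tokenOf, true_and,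
      reduceCtorEq, false_and, false_or, or_false, Token.leaf.injEq]
  · rwa [bitsOf_ofBits l hl]
  · rwa [bitsOf_ofBits l hl]
  all_goals rwa [← take_eq_bitsOf_zero l hl hz]

theorem getD_block {w j : ℕ} (a b : Bool) (i : ℕ) (l : List Bool) (hj : j < w) :
    ([a, b] ++ bitsOf w i ++ l).getD (2 + j) false = i.testBit j := by
  rw [List.getD_append _ _ _ _ (by simp [length_bitsOf]; omega), List.getD_append_right _ _ _ _
    (by simp), List.getD_eq_getElem _ _ (by simp [length_bitsOf]; omega)]
  simp [bitsOf]

theorem headToken_block {w : ℕ} (a b : Bool) (i : ℕ) (l : List Bool) (u : Bool) :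
    headToken w ([a, b] ++ bitsOf w i ++ l) u =
      tokenOf (a, b, (bitsOf w i).any id, true, u) := by
  have h : ((List.range w).any fun j => ([a, b] ++ bitsOf w i ++ l).getD (2 + j) false) =
      (bitsOf w i).any id := by
    rw [show (bitsOf w i).any id = (List.range w).any i.testBit from List.any_map, Bool.eq_iff_iff]
    simp only [List.any_eq_true, List.mem_range]
    exact exists_congr fun j => and_congr_right fun hj => by rw [getD_block _ _ _ _ hj]
  rw [headToken, h]
  have : w + 2 ≤ ([a, b] ++ bitsOf w i ++ l).length := by
    simp [length_bitsOf]
  rw [decide_eq_true this]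
  rfl

theorem drop_block {w : ℕ} (a b : Bool) (i : ℕ) (l : List Bool) :
    ([a, b] ++ bitsOf w i ++ l).drop (w + 2) = l :=
  List.drop_left' (by simp [length_bitsOf])

theorem blockVar_block {w : ℕ} (a b : Bool) (i : Fin (2 ^ w)) (l : List Bool) :
    blockVar w ([a, b] ++ bitsOf w i ++ l) = i := by
  refine Fin.ext (Nat.eq_of_testBit_eq fun j => ?_)
  rcases lt_or_ge j w with hj | hj
  · simp only [blockVar]
    rw [Nat.testBit_ofBits_lt _ _ hj, getD_block _ _ _ _ hj]
  · rw [Nat.testBit_lt_two_pow ((blockVar w _).2.trans_le (Nat.pow_le_pow_right two_pos hj)),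
      Nat.testBit_lt_two_pow (i.2.trans_le (Nat.pow_le_pow_right two_pos hj))]

theorem any_bitsOf_zero (w : ℕ) : (bitsOf w 0).any id = false := by
  simp [bitsOf_zero]

namespace DMFormula

/-- The number of symbols of a formula. -/
def symbols {N : ℕ} : DMFormula N → ℕ
  | var _ => 1
  | not φ => φ.symbols + 1
  | and φ ψ => φ.symbols + ψ.symbols + 1
  | or φ ψ => φ.symbols + ψ.symbols + 1

theorem length_code {w : ℕ} (φ : DMFormula (2 ^ w)) : φ.code.length = φ.symbols * (w + 2) := by
  induction φ with
  | var i => simp [code, symbols, length_bitsOf]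
  | not φ ih => simp [code, symbols, length_bitsOf, ih]; ring
  | and φ ψ ih1 ih2 => simp [code, symbols, length_bitsOf, ih1, ih2]; ring
  | or φ ψ ih1 ih2 => simp [code, symbols, length_bitsOf, ih1, ih2]; ring

/-- Evaluating the notation of a formula pushes its value. -/
theorem foldr_tokens_code {w : ℕ} (σ : Fin (2 ^ w) → Bool) (st : List StackCell)
    (φ : DMFormula (2 ^ w)) : ∀ (q : ℕ) (l : List Bool),
    (tokens w σ (φ.symbols + q) (φ.code ++ l)).foldr Token.step st =
      some (φ.eval σ) :: (tokens w σ q l).foldr Token.step st := by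
  induction φ with
  | var i =>
    intro q l
    rw [symbols, add_comm, tokens, code, List.foldr_cons, headToken_block, drop_block,
      blockVar_block]
    rfl
  | not φ ih =>
    intro q l
    rw [symbols, add_right_comm, tokens, code, List.foldr_cons, List.append_assoc, headToken_block,
      drop_block, any_bitsOf_zero, ih]
    rfl
  | and φ ψ ih1 ih2 =>
    intro q l
    rw [symbols, add_right_comm, tokens, code, List.foldr_cons, List.append_assoc, headToken_block,
      drop_block, any_bitsOf_zero, List.append_assoc φ.code, add_assoc, ih1, ih2]
    rfl
  | or φ ψ ih1 ih2 =>
    intro q l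
    rw [symbols, add_right_comm, tokens, code, List.foldr_cons, List.append_assoc, headToken_block,
      drop_block, any_bitsOf_zero, List.append_assoc φ.code, add_assoc, ih1, ih2]
    rfl

/-- The values at the top of the stack are those of consecutive formulas. -/
theorem exists_of_foldr_tokens {w : ℕ} (σ : Fin (2 ^ w) → Bool) (st : List StackCell)
    (hst : ∀ c ∈ st, c = none) (q : ℕ) : ∀ (l : List Bool) (bs : List Bool),
    bs.map some <+: (tokens w σ q l).foldr Token.step st →
    ∃ φs : List (DMFormula (2 ^ w)), φs.map (eval σ) = bs ∧ φs.flatMap code <+: l := by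
  induction q with
  | zero =>
    intro l bs h
    cases bs with
    | nil => exact ⟨[], rfl, List.nil_prefix⟩
    -- Without symbols only the initial stack remains, and it contains no values.
    | cons b bs => cases hst (some b) (h.subset (by simp))
  | succ q ih =>
    intro l bs h
    cases bs with
    | nil => exact ⟨[], rfl, List.nil_prefix⟩
    | cons b bs =>
      rw [tokens, List.foldr_cons, List.map_cons] at h
      have ih := ih (l.drop (w + 2))
      generalize (tokens w σ q (l.drop (w + 2))).foldr Token.step st = s at h ih
      -- Both binary connectives at once: a value on top forces two values below, hence two
      -- consecutive formulas by induction.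
      have two : ∀ f : Bool → Bool → Bool, some b :: bs.map some <+:
          Option.map₂ f (s.getD 0 none) (s.getD 1 none) :: s.drop 2 →
          ∃ φ ψ : DMFormula (2 ^ w), ∃ φs : List (DMFormula (2 ^ w)),
            f (φ.eval σ) (ψ.eval σ) = b ∧ φs.map (eval σ) = bs ∧
            φ.code ++ ψ.code ++ φs.flatMap code <+: l.drop (w + 2) := by
        intro f h
        rw [List.cons_prefix_cons] at h
        obtain ⟨h1, h2⟩ := h
        match s, ih, h1, h2 with
        | [], _, h1, _ => simp at h1
        | [none], _, h1, _ => simp at h1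
        | [some _], _, h1, _ => simp at h1
        | none :: _ :: _, _, h1, _ => simp at h1
        | some _ :: none :: _, _, h1, _ => simp at h1
        | some c :: some d :: s, ih, h1, h2 =>
          obtain ⟨φs, h3, h4⟩ := ih (c :: d :: bs) (by simpa using h2)
          match φs, h3, h4 with
          | φ :: ψ :: φs, h3, h4 =>
            simp only [List.map_cons, List.cons.injEq] at h3
            refine ⟨φ, ψ, φs, ?_, h3.2.2, by simpa using h4⟩
            rw [h3.1, h3.2.1]
            simpa using h1.symm
      rcases headToken_cases l (σ (blockVar w l)) with
        ht | ⟨ht, hl⟩ | ⟨ht, hl⟩ | ⟨ht, hl⟩ | ⟨ht, hl⟩ <;> rw [ht] at h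
      · simp [Token.step] at h
      · obtain ⟨h1, h2⟩ := List.cons_prefix_cons.1 h
        obtain ⟨φs, h3, h4⟩ := ih bs h2
        refine ⟨var (blockVar w l) :: φs, ?_, ?_⟩
        · rw [List.map_cons, h3]
          exact congrArg (· :: bs) (Option.some.inj h1).symm
        · have := (List.prefix_append_right_inj
            ([false, false] ++ bitsOf w (blockVar w l))).2 h4
          rwa [← hl] at this
      · obtain ⟨h1, h2⟩ := List.cons_prefix_cons.1 h
        match s, ih, h1, h2 with
        | [], _, h1, _ => simp at h1
        | none :: _, _, h1, _ => simp at h1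
        | some c :: s, ih, h1, h2 =>
          obtain ⟨φs, h3, h4⟩ := ih (c :: bs) (by simpa using h2)
          match φs, h3, h4 with
          | φ :: φs, h3, h4 =>
            simp only [List.map_cons, List.cons.injEq] at h3
            refine ⟨not φ :: φs, ?_, ?_⟩
            · simp only [List.map_cons, h3.2, eval, h3.1]
              simpa using h1.symm
            · rw [hl, List.flatMap_cons, code, List.append_assoc]
              exact (List.prefix_append_right_inj _).2 (by simpa using h4)
      · obtain ⟨φ, ψ, φs, h1, h2, h3⟩ := two _ h
        refine ⟨and φ ψ :: φs, ?_, ?_⟩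
        · simp only [List.map_cons, h2, eval]
          exact congrArg (· :: bs) h1
        · rw [hl, List.flatMap_cons, code, List.append_assoc]
          exact (List.prefix_append_right_inj _).2 h3
      · obtain ⟨φ, ψ, φs, h1, h2, h3⟩ := two _ h
        refine ⟨or φ ψ :: φs, ?_, ?_⟩
        · simp only [List.map_cons, h2, eval]
          exact congrArg (· :: bs) h1
        · rw [hl, List.flatMap_cons, code, List.append_assoc]
          exact (List.prefix_append_right_inj _).2 h3

end DMFormula

/-- Satisfiability in terms of the evaluation stack. -/
theorem sat_iff_exists_head (n w : ℕ) (hw : w = Nat.size n) (x : Fin n → Bool) (st : List StackCell)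
    (hst : ∀ c ∈ st, c = none) : SAT n x ↔ ∃ σ : Fin (2 ^ w) → Bool,
      ((tokens w σ (2 ^ w) (List.ofFn x)).foldr Token.step st).head? =
        some (some true) := by
  subst hw
  constructor
  · rintro ⟨φ, ⟨l, hl⟩, σ, hσ⟩
    refine ⟨σ, ?_⟩
    -- Since `n < 2 ^ Nat.size n`, reading `2 ^ w` blocks covers the whole formula. The blocks after
    -- it act on the stack earlier and only affect what lies below its value.
    have h1 : φ.symbols ≤ 2 ^ Nat.size n := by
      have := congrArg List.length hl
      rw [List.length_append, DMFormula.length_code, List.length_ofFn] at this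
      have := Nat.lt_size_self n
      nlinarith [Nat.zero_le (φ.symbols * Nat.size n)]
    obtain ⟨q, hq⟩ := Nat.exists_eq_add_of_le h1
    rw [← hl, hq, DMFormula.foldr_tokens_code, hσ]
    rfl
  · rintro ⟨σ, h⟩
    obtain ⟨φs, h1, h2⟩ := DMFormula.exists_of_foldr_tokens σ st hst _ (List.ofFn x) [true]
      (by
        obtain ⟨s, hs⟩ := List.head?_eq_some_iff.1 h
        rw [hs]
        simp)
    match φs, h1, h2 with
    | [], h1, _ => simp at h1
    | _ :: _ :: _, h1, _ => simp at h1
    | [φ], h1, h2 => exact ⟨φ, by simpa using h2, σ, by simpa using h1⟩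

/-! ### Circuits and gate complexity -/

/-- The bits on the wires after the gates `gs`, starting with the bits `vs`. -/
def runGates (vs : List Bool) (gs : List BoolGate) : List Bool :=
  gs.foldl (fun vs g => vs ++ [g.eval fun a => vs.getD a false]) vs

/-- The gates read only earlier wires when the first gate has number `k`. -/
def GatesBelow (k : ℕ) (gs : List BoolGate) : Prop :=
  ∀ (i : ℕ) (h : i < gs.length), (gs[i]).Below (k + i)

theorem runGates_append (vs : List Bool) (gs hs : List BoolGate) :
    runGates vs (gs ++ hs) = runGates (runGates vs gs) hs := List.foldl_append

theorem length_runGates (vs : List Bool) (gs : List BoolGate) :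
    (runGates vs gs).length = vs.length + gs.length := by
  induction gs generalizing vs with
  | nil => rfl
  | cons g gs ih =>
    rw [show runGates vs (g :: gs) = runGates (vs ++ [g.eval fun a => vs.getD a false]) gs from rfl,
      ih]
    simp; omega

theorem GatesBelow.append {k : ℕ} {gs hs : List BoolGate} (h : GatesBelow k gs)
    (h' : GatesBelow (k + gs.length) hs) : GatesBelow k (gs ++ hs) := by
  intro i hi
  rcases lt_or_ge i gs.length with hg | hg
  · rw [List.getElem_append_left hg]; exact h i hg
  · rw [List.getElem_append_right hg]
    have := h' (i - gs.length) (by rw [List.length_append] at hi; omega)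
    rwa [add_assoc, Nat.add_sub_cancel' hg] at this

theorem BoolGate.Below.mono {k l : ℕ} {g : BoolGate} (h : g.Below k) (hkl : k ≤ l) :
    g.Below l := by
  cases g with
  | const b => trivial
  | not a => exact lt_of_lt_of_le h hkl
  | and a b => exact ⟨h.1.trans_le hkl, h.2.trans_le hkl⟩
  | or a b => exact ⟨h.1.trans_le hkl, h.2.trans_le hkl⟩

theorem GatesBelow.of_forall {k : ℕ} {gs : List BoolGate} (h : ∀ g ∈ gs, g.Below k) :
    GatesBelow k gs := fun _ hi => (h _ (List.getElem_mem hi)).mono (Nat.le_add_right _ _)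

theorem runGates_singleton (vs : List Bool) (g : BoolGate) :
    runGates vs [g] = vs ++ [g.eval fun a => vs.getD a false] := rfl

theorem getD_runGates {vs : List Bool} {gs : List BoolGate} {a : ℕ} (h : a < vs.length) :
    (runGates vs gs).getD a false = vs.getD a false := by
  induction gs generalizing vs with
  | nil => rfl
  | cons g gs ih =>
    rw [show runGates vs (g :: gs) = runGates (vs ++ [g.eval fun a => vs.getD a false]) gs from rfl,
      ih (by rw [List.length_append]; omega), List.getD_append _ _ _ _ h]

/-- A derivation from the input bits is realized by gates. -/
theorem Derives.exists_gates {N s : ℕ} {T : Set ((Fin N → Bool) → Bool)}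
    (h : Derives Wired.coords s T) : ∃ gs : List BoolGate, gs.length ≤ s ∧ GatesBelow N gs ∧
      ∀ f ∈ T, ∃ a < N + gs.length, ∀ x, (runGates (List.ofFn x) gs).getD a false = f x := by
  have snoc : ∀ (s : ℕ) (T : Set ((Fin N → Bool) → Bool)) (gs : List BoolGate) (g : BoolGate)
      (f₀ : (Fin N → Bool) → Bool), gs.length ≤ s → GatesBelow N gs →
      (∀ f ∈ T, ∃ a < N + gs.length, ∀ x, (runGates (List.ofFn x) gs).getD a false = f x) →
      g.Below (N + gs.length) →
      (∀ x, (g.eval fun a => (runGates (List.ofFn x) gs).getD a false) = f₀ x) →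
      ∃ gs : List BoolGate, gs.length ≤ s + 1 ∧ GatesBelow N gs ∧ ∀ f ∈ insert f₀ T,
        ∃ a < N + gs.length, ∀ x, (runGates (List.ofFn x) gs).getD a false = f x := by
    intro s T gs g f₀ h1 h2 h3 h4 h5
    refine ⟨gs ++ [g], by simpa using h1, h2.append (GatesBelow.of_forall (by simpa using h4)), ?_⟩
    rintro f (rfl | hf)
    · refine ⟨N + gs.length, by simp, fun x => ?_⟩
      rw [runGates_append, runGates_singleton, List.getD_append_right _ _ _ _ (by
        simp [length_runGates]), ← h5]
      simp [length_runGates]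
    · obtain ⟨a, ha, h⟩ := h3 f hf
      refine ⟨a, by rw [List.length_append]; omega, fun x => ?_⟩
      rw [runGates_append, getD_runGates (by simpa [length_runGates] using ha), h]
  induction h with
  | base =>
    refine ⟨[], le_rfl, fun i hi => by simp at hi, ?_⟩
    intro f hf
    obtain ⟨i, c, rfl, rfl⟩ := Set.mem_iUnion.1 hf
    exact ⟨i, i.2, fun x => by simp [runGates]⟩
  | const b _ ih =>
    obtain ⟨gs, h1, h2, h3⟩ := ih
    exact snoc _ _ gs (.const b) _ h1 h2 h3 trivial fun _ => rfl
  | not _ hf ih =>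
    obtain ⟨gs, h1, h2, h3⟩ := ih
    obtain ⟨a, ha, h⟩ := h3 _ hf
    exact snoc _ _ gs (.not a) _ h1 h2 h3 ha fun x => by rw [BoolGate.eval, h]
  | and _ hf hg ih =>
    obtain ⟨gs, h1, h2, h3⟩ := ih
    obtain ⟨a, ha, h⟩ := h3 _ hf
    obtain ⟨b, hb, h'⟩ := h3 _ hg
    exact snoc _ _ gs (.and a b) _ h1 h2 h3 ⟨ha, hb⟩ fun x => by rw [BoolGate.eval, h, h']
  | or _ hf hg ih =>
    obtain ⟨gs, h1, h2, h3⟩ := ih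
    obtain ⟨a, ha, h⟩ := h3 _ hf
    obtain ⟨b, hb, h'⟩ := h3 _ hg
    exact snoc _ _ gs (.or a b) _ h1 h2 h3 ⟨ha, hb⟩ fun x => by rw [BoolGate.eval, h, h']
  | weaken _ hs hU ih =>
    obtain ⟨gs, h1, h2, h3⟩ := ih
    exact ⟨gs, h1.trans hs, h2, fun f hf => h3 f (hU hf)⟩

theorem HasCost.exists_circuit {N s : ℕ} {f : (Fin N → Bool) → Bool} (h : HasCost f s) :
    ∃ C : BoolCircuit N 1, C.size ≤ s ∧ ∀ x, C.eval x 0 = f x := by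
  obtain ⟨gs, h1, h2, h3⟩ := Derives.exists_gates h
  obtain ⟨a, ha, h⟩ := h3 f ⟨_, rfl, rfl⟩
  exact ⟨⟨gs, fun _ => a, h2, fun _ => ha⟩, h1, h⟩

/-- The converse of `Derives.exists_gates`, with inputs that may be arbitrary functions on `Ω`; it
lets given circuits enter the cost calculus. -/
theorem Derives.runGates {Ω : Type} {I : Set (Ω → Bool)} (gs : List BoolGate) :
    ∀ (s k : ℕ) (vs : Ω → List Bool) (T : Set (Ω → Bool)), GatesBelow k gs →
    (∀ ω, (vs ω).length = k) → Derives I s T → (∀ a < k, (fun ω => (vs ω).getD a false) ∈ T) →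
    ∃ U, Derives I (s + gs.length) U ∧
      ∀ a < k + gs.length, (fun ω => (_root_.runGates (vs ω) gs).getD a false) ∈ U := by
  induction gs with
  | nil => exact fun s k vs T _ _ hT h => ⟨T, hT, h⟩
  | cons g gs ih =>
    intro s k vs T hg hk hT h
    have hg0 : g.Below k := hg 0 (by simp)
    have hgs : GatesBelow (k + 1) gs := fun i hi => by
      have := hg (i + 1) (by simpa using hi)
      rwa [← add_assoc, add_right_comm] at this
    have hd : Derives I (s + 1) (insert (fun ω => g.eval fun a => (vs ω).getD a false) T) := by
      cases g with
      | const b => exact hT.const b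
      | not a => exact hT.not (h a hg0)
      | and a b => exact hT.and (h a hg0.1) (h b hg0.2)
      | or a b => exact hT.or (h a hg0.1) (h b hg0.2)
    obtain ⟨U, hU, h'⟩ := ih (s + 1) (k + 1)
      (fun ω => vs ω ++ [g.eval fun a => (vs ω).getD a false]) _ hgs (by simp [hk]) hd (by
        intro a ha
        rcases Nat.lt_succ_iff_lt_or_eq.1 ha with ha | rfl
        · refine Or.inr ?_
          have : (fun ω => (vs ω ++ [g.eval fun a => (vs ω).getD a false]).getD a false) =
              fun ω => (vs ω).getD a false :=
            funext fun ω => List.getD_append _ _ _ _ (by rwa [hk])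
          rw [this]
          exact h a ha
        · refine Or.inl (funext fun ω => ?_)
          rw [List.getD_append_right _ _ _ _ (hk ω).le]
          simp [hk])
    refine ⟨U, hU.weaken (by simp; omega) subset_rfl, fun a ha => h' a ?_⟩
    rw [List.length_cons] at ha
    omega

theorem BoolCircuit.hasCost_eval {N p : ℕ} (C : BoolCircuit N p) : HasCost C.eval C.size := by
  obtain ⟨U, hU, h⟩ := Derives.runGates C.gates 0 N (fun x => List.ofFn x) Wired.coords
    C.gates_below (fun _ => List.length_ofFn) Derives.base (by
      intro a ha
      refine Set.mem_iUnion.2 ⟨⟨a, ha⟩, id, rfl, funext fun x => ?_⟩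
      simp [ha])
  refine hU.weaken (by simp [size]) ?_
  rintro _ ⟨_, hc, rfl⟩
  obtain ⟨i, c, rfl, rfl⟩ := Set.mem_iUnion.1 hc
  exact h _ (C.out_lt i)

/-! ### A quasilinear circuit for formula evaluation -/

theorem HasCost.list_any {α κ : Type} [Wired α] {s : ℕ} (l : List κ) (F : κ → α → Bool)
    (h : ∀ i ∈ l, HasCost (F i) s) :
    HasCost (fun a => l.any fun i => F i a) (l.length * (s + 1) + 2) := by
  induction l with
  | nil => simpa using HasCost.const (α := α) false
  | cons i l ih =>
    have := (h i List.mem_cons_self).or (ih fun j hj => h j (List.mem_cons_of_mem _ hj))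
    simp only [List.any_cons]
    exact this.mono (by rw [List.length_cons]; linarith)

theorem hasCost_getD_drop {n : ℕ} (a i : ℕ) :
    HasCost (fun x : Fin n → Bool => ((List.ofFn x).drop a).getD i false) 2 := by
  by_cases h : a + i < n
  · have : (fun x : Fin n → Bool => ((List.ofFn x).drop a).getD i false) =
        fun x => x ⟨a + i, h⟩ := by
      funext x
      simp [List.getD_eq_getElem?_getD, h]
    rw [this]
    exact (HasCost.proj _).mono (by omega)
  · have : (fun x : Fin n → Bool => ((List.ofFn x).drop a).getD i false) = fun x => false := by
      funext x
      simp [List.getD_eq_getElem?_getD, h]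
    rw [this]
    exact HasCost.const _

/-- For `2 ^ w` symbols the levels up to `w` suffice: the last buffer starts with two blocks and
changes by at most two, so nothing is needed below it. -/
theorem exists_stack_evaluator : ∃ K : ℕ, ∀ w, 1 ≤ w → ∃ (f : PerfTree Token w → StackCell)
    (st : List StackCell), (∀ c ∈ st, c = none) ∧ HasCost f (K * 2 ^ w * (w + 1)) ∧
      ∀ t, ((PerfTree.leaves w t).foldr Token.step st).head? = some (f t) := by
  obtain ⟨K, hK⟩ := LowStack.exists_hasCost_run
  refine ⟨K + 2, fun w hw => ?_⟩
  -- As `w` is positive, level 0 is among the balanced levels, so its first block is in use and is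
  -- the top of the stack.
  obtain ⟨j, rfl⟩ := Nat.exists_eq_add_of_le' hw
  refine ⟨fun t => LowStack.top j (LowStack.run (j + 1) (t, LowStack.initial (j + 2))).1,
    LowStack.toList (j + 2) (LowStack.initial (j + 2)), LowStack.toList_initial _, ?_, fun t => ?_⟩
  · have h1 := (hK (j + 1)).comp (HasCost.id.pair
      (HasCost.const (α := PerfTree Token (j + 1)) (LowStack.initial (j + 2))))
    refine ((LowStack.hasCost_top j).comp (HasCost.fst.comp h1)).mono ?_
    have : 1 ≤ 2 ^ (j + 1) * (j + 1 + 1) := Nat.mul_pos (by positivity) (by omega)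
    nlinarith
  · obtain ⟨h1, -, -, h2⟩ := LowStack.runCorrect (j + 1) t (LowStack.initial (j + 1))
      (LowStack.initial (j + 2)).2 [] (LowStack.balanced_initial _) (Or.inl rfl)
    have e : LowStack.toList (j + 2) (LowStack.initial (j + 2)) =
      LowStack.toList (j + 1) (LowStack.initial (j + 1)) ++
        LowStack.entries (j + 1) (LowStack.initial (j + 2)).2 ++ [] :=
      (List.append_nil _).symm
    rw [e, ← h2, List.append_assoc, List.head?_append, LowStack.head_toList j _ h1]
    rfl

/-- Quasilinear circuits refute formulas, given the values of the variables in their blocks. -/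
theorem exists_unsat_circuit : ∃ K : ℕ, ∀ n w : ℕ, 1 ≤ w → w = Nat.size n →
    ∃ V : BoolCircuit (n + 2 ^ w) 1, V.size ≤ K * 2 ^ w * (w + 1) ∧
      ∀ x : Fin n → Bool, SAT n x ↔ ∃ σ : Fin (2 ^ w) → Bool,
        V.eval (Fin.append x fun p => σ (blockVar w ((List.ofFn x).drop (p * (w + 2))))) 0 =
          false := by
  obtain ⟨K₁, hK₁⟩ := exists_stack_evaluator
  obtain ⟨K₂, hK₂⟩ := HasCost.exists_of_finite tokenOf
  refine ⟨K₁ + K₂ + 9, ?_⟩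
  intro n w hw hwdef
  obtain ⟨f, st, hst, hf, hf'⟩ := hK₁ w hw
  let tok : (Fin (n + 2 ^ w) → Bool) → ℕ → Token := fun z p =>
    headToken w ((List.ofFn fun i : Fin n => z (Fin.castAdd _ i)).drop (p * (w + 2)))
      (if h : p < 2 ^ w then z (Fin.natAdd n ⟨p, h⟩) else false)
  have hx : ∀ a i, HasCost (fun z : Fin (n + 2 ^ w) → Bool =>
      ((List.ofFn fun i : Fin n => z (Fin.castAdd _ i)).drop a).getD i false) 2 := fun a i => by
    have := (hasCost_getD_drop (n := n) a i).comp (HasCost.reindex (α := Bool)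
      (Fin.castAdd (n := n) (2 ^ w)))
    exact this
  have htok : ∀ p < 2 ^ w, HasCost (fun z => tok z p) (K₂ + 8 + 3 * w) := by
    intro p hp
    have hu : HasCost (fun z : Fin (n + 2 ^ w) → Bool =>
        if h : p < 2 ^ w then z (Fin.natAdd n ⟨p, h⟩) else false) 0 := by
      simp only [hp, dite_true]
      exact HasCost.proj _
    have hlen : HasCost (fun z : Fin (n + 2 ^ w) → Bool => decide (w + 2 ≤
        ((List.ofFn fun i : Fin n => z (Fin.castAdd _ i)).drop (p * (w + 2))).length)) 2 := by
      simp only [List.length_drop, List.length_ofFn]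
      exact HasCost.const _
    have hany := HasCost.list_any (List.range w) (fun i (z : Fin (n + 2 ^ w) → Bool) =>
      ((List.ofFn fun i : Fin n => z (Fin.castAdd _ i)).drop (p * (w + 2))).getD (2 + i) false)
      fun i _ => hx _ _
    refine (hK₂.comp ((hx (p * (w + 2)) 0).pair ((hx (p * (w + 2)) 1).pair
      (hany.pair (hlen.pair hu))))).mono ?_
    rw [List.length_range]
    omega
  have hF := hf.comp (PerfTree.hasCost_ofFun w tok htok)
  -- The output is negated: `V` outputs `true` unless the assignment satisfies the formula, so
  -- universal acceptance will mean unsatisfiability.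
  have hF := HasCost.of_full hF rfl fun c => !decide (c = some true)
  obtain ⟨V, hV, hV'⟩ := hF.exists_circuit
  refine ⟨V, hV.trans ?_, fun x => ?_⟩
  · have : 1 ≤ 2 ^ w := Nat.one_le_two_pow
    nlinarith [Nat.zero_le (2 ^ w * w * K₂), Nat.zero_le (2 ^ w * w)]
  · rw [sat_iff_exists_head n w hwdef x st hst]
    refine exists_congr fun σ => ?_
    rw [hV', tokens_eq_map]
    have : (List.range (2 ^ w)).map (fun p => headToken w ((List.ofFn x).drop (p * (w + 2)))
        (σ (blockVar w ((List.ofFn x).drop (p * (w + 2)))))) = PerfTree.leaves w (PerfTree.ofFun w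
        (tok (Fin.append x fun p => σ (blockVar w ((List.ofFn x).drop (p * (w + 2))))))) := by
      rw [PerfTree.leaves_ofFun]
      refine List.map_congr_left fun p hp => ?_
      simp only [tok, List.mem_range.1 hp, dite_true, Fin.append_left, Fin.append_right]
    rw [this, hf']
    simp

/-! ### Circuits with a hardwired formula -/

namespace BoolGate

/-- The gate with all its wire numbers increased by `k`. -/
def shift (k : ℕ) : BoolGate → BoolGate
  | const b => const b
  | not a => not (k + a)
  | and a b => and (k + a) (k + b)
  | or a b => or (k + a) (k + b)

theorem Below.shift {k l : ℕ} {g : BoolGate} (h : g.Below l) : (g.shift k).Below (k + l) := by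
  cases g with
  | const b => trivial
  | not a => exact Nat.add_lt_add_left h k
  | and a b => exact ⟨Nat.add_lt_add_left h.1 k, Nat.add_lt_add_left h.2 k⟩
  | or a b => exact ⟨Nat.add_lt_add_left h.1 k, Nat.add_lt_add_left h.2 k⟩

theorem eval_shift (us vs : List Bool) (g : BoolGate) :
    (g.shift us.length).eval (fun a => (us ++ vs).getD a false) =
      g.eval fun a => vs.getD a false := by
  have h : ∀ a, (us ++ vs).getD (us.length + a) false = vs.getD a false := fun a => by
    rw [List.getD_append_right _ _ _ _ (Nat.le_add_right _ _), Nat.add_sub_cancel_left]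
  cases g <;> simp only [shift, eval, h]

end BoolGate

theorem GatesBelow.shift {k l : ℕ} {gs : List BoolGate} (h : GatesBelow l gs) :
    GatesBelow (k + l) (gs.map (BoolGate.shift k)) := by
  intro i hi
  rw [List.length_map] at hi
  rw [List.getElem_map, add_assoc]
  exact (h i hi).shift

theorem runGates_shift (us vs : List Bool) (gs : List BoolGate) :
    runGates (us ++ vs) (gs.map (BoolGate.shift us.length)) = us ++ runGates vs gs := by
  induction gs generalizing vs with
  | nil => rfl
  | cons g gs ih =>
    have : runGates (us ++ vs) ((g :: gs).map (BoolGate.shift us.length)) =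
        runGates (us ++ vs ++ [(g.shift us.length).eval fun a => (us ++ vs).getD a false])
          (gs.map (BoolGate.shift us.length)) := rfl
    rw [this, BoolGate.eval_shift, List.append_assoc, ih]
    rfl

theorem runGates_const (vs bs : List Bool) :
    runGates vs (bs.map BoolGate.const) = vs ++ bs := by
  induction bs generalizing vs with
  | nil => simp [runGates]
  | cons b bs ih =>
    have : runGates vs ((b :: bs).map BoolGate.const) =
      runGates (vs ++ [b]) (bs.map BoolGate.const) := rfl
    rw [this, ih, List.append_assoc]
    rfl

/-- The gates `and a a` bring the values of the variables into consecutive wires, where the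
evaluation circuit expects them. -/
theorem runGates_copy (vs ws : List Bool) (as : List ℕ) (h : ∀ a ∈ as, a < vs.length) :
    runGates (vs ++ ws) (as.map fun a => BoolGate.and a a) =
      vs ++ (ws ++ as.map fun a => vs.getD a false) := by
  induction as generalizing ws with
  | nil => simp [runGates]
  | cons a as ih =>
    have : runGates (vs ++ ws) ((a :: as).map fun a => BoolGate.and a a) =
      runGates (vs ++ ws ++ [(vs ++ ws).getD a false && (vs ++ ws).getD a false])
        (as.map fun a => BoolGate.and a a) := rfl
    rw [this, Bool.and_self, List.getD_append _ _ _ _ (h a List.mem_cons_self), List.append_assoc,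
      ih _ fun b hb => h b (List.mem_cons_of_mem _ hb)]
    simp

/-- The number of the nondeterministic wire for the variable in the `p`-th block of `x`. -/
def varWire (w : ℕ) {n : ℕ} (x : Fin n → Bool) (p : ℕ) : ℕ :=
  2 ^ w + blockVar w ((List.ofFn x).drop (p * (w + 2)))

/-- The gates that provide the inputs of a circuit for formula evaluation, followed by the gates of
that circuit: the bits of `x`, and the values of the variables in the blocks of `x`. -/
def hardwiredGates (w l : ℕ) {n : ℕ} (x : Fin n → Bool) (gs : List BoolGate) : List BoolGate :=
  (List.ofFn x).map BoolGate.const ++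
    ((List.range (2 ^ w)).map (varWire w x)).map (fun a => BoolGate.and a a) ++
      gs.map (BoolGate.shift (l + 2 ^ (w + 1)))

theorem varWire_lt (w l : ℕ) {n : ℕ} (x : Fin n → Bool) (p : ℕ) :
    varWire w x p < l + 2 ^ (w + 1) := by
  have := (blockVar w ((List.ofFn x).drop (p * (w + 2)))).2
  rw [varWire, pow_succ]
  omega

/-- The co-nondeterministic circuit on `l` inputs that ignores them and runs `V` on `x` and all the
assignments to the variables. -/
def hardwired (w l : ℕ) {n : ℕ} (x : Fin n → Bool) (V : BoolCircuit (n + 2 ^ w) 1) :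
    CoNondetCircuit l where
  -- The variables use the wires `2 ^ w + v` with `v < 2 ^ w`. For `l ≤ 2 ^ w` these are
  -- nondeterministic wires, and `2 ^ (w + 1)` such wires reach far enough for every `l`.
  m := 2 ^ (w + 1)
  circuit :=
    { gates := hardwiredGates w l x V.gates
      out := fun j => l + 2 ^ (w + 1) + V.out j
      gates_below := by
        refine GatesBelow.append (GatesBelow.append (GatesBelow.of_forall ?_)
          (GatesBelow.of_forall ?_)) ?_
        · simp [BoolGate.Below]
        · simp only [List.mem_map, forall_exists_index, and_imp, forall_apply_eq_imp_iff₂]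
          intro p _
          have := varWire_lt w l x p
          constructor <;> omega
        · have := GatesBelow.shift (k := l + 2 ^ (w + 1)) (l := n + 2 ^ w) V.gates_below
          simpa using this
      out_lt := fun j => by
        have := V.out_lt j
        simp only [hardwiredGates, List.length_append, List.length_map, List.length_ofFn,
          List.length_range]
        omega }

theorem size_hardwired (w l : ℕ) {n : ℕ} (x : Fin n → Bool) (V : BoolCircuit (n + 2 ^ w) 1) :
    (hardwired w l x V).size = 2 ^ (w + 1) + (n + 2 ^ w + V.size) := by
  simp [CoNondetCircuit.size, BoolCircuit.size, hardwired, hardwiredGates, add_assoc]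

theorem eval_hardwired (w l : ℕ) {n : ℕ} (x : Fin n → Bool) (V : BoolCircuit (n + 2 ^ w) 1)
    (z : Fin (l + 2 ^ (w + 1)) → Bool) :
    (hardwired w l x V).circuit.eval z 0 =
      V.eval (Fin.append x fun p => (List.ofFn z).getD (varWire w x p) false) 0 := by
  have hlen : (List.ofFn z).length = l + 2 ^ (w + 1) := List.length_ofFn
  have hu : List.ofFn (fun p : Fin (2 ^ w) => (List.ofFn z).getD (varWire w x p) false) =
      ((List.range (2 ^ w)).map (varWire w x)).map fun a => (List.ofFn z).getD a false := by
    refine List.ext_getElem (by simp) fun i h1 h2 => ?_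
    simp
  have hw : (hardwired w l x V).circuit.wires z = List.ofFn z ++
      V.wires (Fin.append x fun p => (List.ofFn z).getD (varWire w x p) false) := by
    change runGates (List.ofFn z) (hardwiredGates w l x V.gates) = _ ++ runGates _ V.gates
    rw [hardwiredGates, runGates_append, runGates_append, runGates_const, runGates_copy,
      List.ofFn_fin_append, hu]
    · have := runGates_shift (List.ofFn z) (List.ofFn x ++ ((List.range (2 ^ w)).map
        (varWire w x)).map fun a => (List.ofFn z).getD a false) V.gates
      rwa [hlen] at this
    simp only [List.mem_map, forall_exists_index, and_imp, forall_apply_eq_imp_iff₂]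
    intro p _
    rw [hlen]
    exact varWire_lt w l x p
  refine (congrArg (fun vs => vs.getD (l + 2 ^ (w + 1) + V.out 0) false) hw).trans ?_
  change List.getD _ _ _ = List.getD _ _ _
  rw [List.getD_append_right _ _ _ _ (by rw [hlen]; omega), hlen, Nat.add_sub_cancel_left]

/-- The assumption `l ≤ 2 ^ w` makes all variable wires nondeterministic: variable `i` is bit `2 ^ w
- l + i` of `y`. Hence `y` ranges over all assignments and `z` plays no role. -/
theorem accepts_hardwired_iff {w l n : ℕ} (hl : l ≤ 2 ^ w) (x : Fin n → Bool)
    (V : BoolCircuit (n + 2 ^ w) 1) (z : Fin l → Bool) :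
    (hardwired w l x V).Accepts z ↔ ∀ σ : Fin (2 ^ w) → Bool,
      V.eval (Fin.append x fun p => σ (blockVar w ((List.ofFn x).drop (p * (w + 2))))) 0 =
        true := by
  have key : ∀ (y : Fin (2 ^ (w + 1)) → Bool) (i : Fin (2 ^ w)),
      (List.ofFn (Fin.append z y)).getD (2 ^ w + i) false =
        y ⟨2 ^ w - l + i, by have := i.2; rw [pow_succ]; omega⟩ := by
    intro y i
    have hi := i.2
    rw [List.ofFn_fin_append, List.getD_append_right _ _ _ _ (by simp; omega),
      List.getD_eq_getElem _ _ (by simp [pow_succ]; omega), List.getElem_ofFn]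
    congr 2
    rw [List.length_ofFn]
    omega
  have h : ∀ y : Fin (2 ^ (w + 1)) → Bool, (hardwired w l x V).circuit.eval (Fin.append z y) 0 =
      V.eval (Fin.append x fun p => (fun i : Fin (2 ^ w) =>
        y ⟨2 ^ w - l + i, by have := i.2; rw [pow_succ]; omega⟩)
          (blockVar w ((List.ofFn x).drop (p * (w + 2))))) 0 := by
    intro y
    refine (eval_hardwired w l x V (Fin.append z y)).trans ?_
    simp only [varWire, key]
  constructor
  · intro hz σ
    have := hz fun j : Fin (2 ^ (w + 1)) =>
      if hj : (j : ℕ) - (2 ^ w - l) < 2 ^ w then σ ⟨_, hj⟩ else false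
    rw [h] at this
    simpa using this
  · intro hσ (y : Fin (2 ^ (w + 1)) → Bool)
    exact (h y).trans (hσ fun i => y ⟨2 ^ w - l + i, by have := i.2; rw [pow_succ]; omega⟩)

/-! ### Descriptions made of constants and input bits -/

/-- All the bits are constants or bits of `x`. -/
def IsLiteral {n : ℕ} (l : (Fin n → Bool) → List Bool) : Prop :=
  ∃ fs : List ((Fin n → Bool) → Bool),
    (∀ f ∈ fs, (∃ b, ∀ x, f x = b) ∨ ∃ j, ∀ x, f x = x j) ∧ ∀ x, l x = fs.map fun f => f x

namespace IsLiteral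

variable {n : ℕ} {l l' : (Fin n → Bool) → List Bool}

theorem const (l : List Bool) : IsLiteral fun _ : Fin n → Bool => l :=
  ⟨l.map fun b _ => b, by
    simp only [List.mem_map]
    rintro _ ⟨b, -, rfl⟩
    exact Or.inl ⟨b, fun _ => rfl⟩, fun x => by simp [Function.comp_def]⟩

theorem append (h : IsLiteral l) (h' : IsLiteral l') : IsLiteral fun x => l x ++ l' x := by
  obtain ⟨fs, h1, h2⟩ := h
  obtain ⟨gs, h3, h4⟩ := h'
  refine ⟨fs ++ gs, fun f hf => ?_, fun x => by simp only [h2, h4, List.map_append]⟩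
  exact (List.mem_append.1 hf).elim (h1 f) (h3 f)

theorem flatMap {κ : Type} (L : List κ) (g : κ → (Fin n → Bool) → List Bool)
    (h : ∀ i ∈ L, IsLiteral (g i)) : IsLiteral fun x => L.flatMap fun i => g i x := by
  induction L with
  | nil => exact const []
  | cons i L ih =>
    exact (h i List.mem_cons_self).append (ih fun j hj => h j (List.mem_cons_of_mem _ hj))

theorem map {κ : Type} (L : List κ) (g : κ → (Fin n → Bool) → Bool)
    (h : ∀ i ∈ L, (∃ b, ∀ x, g i x = b) ∨ ∃ j, ∀ x, g i x = x j) :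
    IsLiteral fun x => L.map fun i => g i x :=
  ⟨L.map g, by simpa using h, fun x => by simp⟩

theorem getD (h : IsLiteral l) (i : ℕ) :
    (∃ b, ∀ x, (l x).getD i false = b) ∨ ∃ j, ∀ x, (l x).getD i false = x j := by
  obtain ⟨fs, h1, h2⟩ := h
  by_cases hi : i < fs.length
  · have : ∀ x, (l x).getD i false = fs[i] x := fun x => by
      rw [h2, List.getD_eq_getElem _ _ (by simpa using hi), List.getElem_map]
    simpa only [this] using h1 _ (List.getElem_mem hi)
  · exact Or.inl ⟨false, fun x => by
      rw [h2, List.getD_eq_default _ _ (by simpa using hi)]⟩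

end IsLiteral

theorem testBit_two_pow_add {w i : ℕ} (hi : i < 2 ^ w) (j : ℕ) :
    (2 ^ w + i).testBit j = (decide (w = j) || i.testBit j) := by
  have := Nat.two_pow_add_eq_or_of_lt hi 1
  rw [mul_one] at this
  rw [this, Nat.testBit_or, Nat.testBit_two_pow]

/-- The offset `2 ^ w` causes no carries: the digits below `w` are the variable field of the block,
hence bits of `x` or `false` past its end, digit `w` is 1, and the higher ones are 0. An offset such
as `l` would require an addition. -/
theorem isLiteral_bitsOf_varWire (A w n p : ℕ) :
    IsLiteral fun x : Fin n → Bool => bitsOf A (varWire w x p) := by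
  refine IsLiteral.map _ (fun j (x : Fin n → Bool) => (varWire w x p).testBit j) fun j _ => ?_
  simp only [varWire, testBit_two_pow_add (blockVar w _).2]
  by_cases hj : w = j
  · exact Or.inl ⟨true, fun x => by simp [hj]⟩
  · simp only [hj, decide_false, Bool.false_or]
    rcases lt_or_gt_of_ne hj with hj | hj
    · exact Or.inl ⟨false, fun x => Nat.testBit_lt_two_pow
        ((blockVar w _).2.trans_le (Nat.pow_le_pow_right two_pos hj.le))⟩
    · simp only [blockVar, Nat.testBit_ofBits_lt _ _ hj, List.getD_eq_getElem?_getD,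
        List.getElem?_drop, List.getElem?_ofFn]
      by_cases h : p * (w + 2) + (2 + j) < n
      · exact Or.inr ⟨⟨_, h⟩, fun x => by simp [h]⟩
      · exact Or.inl ⟨false, fun x => by simp [h]⟩

/-- The description of `hardwired w l x V` consists of constants and bits of `x`. -/
theorem hasCost_desc_hardwired (w l s : ℕ) {n : ℕ} (V : BoolCircuit (n + 2 ^ w) 1) :
    HasCost (fun x : Fin n → Bool => (hardwired w l x V).desc s) 2 := by
  refine HasCost.of_literals fun i => ?_
  refine IsLiteral.getD (l := fun x => (hardwired w l x V).code s) ?_ i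
  generalize hA : CoNondetCircuit.addrWidth l s = A
  change IsLiteral fun x : Fin n → Bool => bitsOf (CoNondetCircuit.addrWidth l s) (2 ^ (w + 1)) ++
    bitsOf (CoNondetCircuit.addrWidth l s) (l + 2 ^ (w + 1) + V.out 0) ++
      (hardwiredGates w l x V.gates).flatMap (BoolGate.code (CoNondetCircuit.addrWidth l s))
  rw [hA]
  refine (IsLiteral.const _).append ?_
  simp only [hardwiredGates, List.flatMap_append, List.flatMap_map]
  refine (IsLiteral.append ?_ ?_).append (.const _)
  · have : ∀ x : Fin n → Bool, List.ofFn x = (List.finRange n).map x := fun x =>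
      List.ofFn_eq_map
    simp only [this, List.flatMap_map]
    refine IsLiteral.flatMap _ (fun i (x : Fin n → Bool) => BoolGate.code A (.const (x i)))
      fun i _ => ?_
    refine (IsLiteral.append ?_ (.const _)).append (.const _)
    exact IsLiteral.append (.const [true, false]) ⟨[fun x => x i],
      fun f hf => Or.inr ⟨i, fun x => by rw [List.mem_singleton.1 hf]⟩, fun x => rfl⟩
  · refine IsLiteral.flatMap _ (fun p (x : Fin n → Bool) =>
      BoolGate.code A (.and (varWire w x p) (varWire w x p))) fun p _ => ?_
    exact ((IsLiteral.const _).append (isLiteral_bitsOf_varWire A w n p)).append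
      (isLiteral_bitsOf_varWire A w n p)

/-! ### From refuters to circuits for SAT, and back to a contradiction -/

/-- `SAT` on strings of length `n` is decided by a circuit with at most `s` gates. -/
def SatSize (n s : ℕ) : Prop :=
  ∃ f : (Fin n → Bool) → Bool, HasCost f s ∧ ∀ x, f x = true ↔ SAT n x

/-- A refuter on length `l` reduces satisfiability on length `n` to length `l`. -/
theorem exists_satSize_of_refutes : ∃ K : ℕ, ∀ n l s t : ℕ, 1 ≤ n → l ≤ n →
    K * 2 ^ Nat.size n * (Nat.size n + 1) ≤ s → ∀ R : BoolCircuit (CoNondetCircuit.descLen l s) l,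
    Refutes SAT l s R → SatSize l t → SatSize n (2 + R.size + t) := by
  obtain ⟨K, hK⟩ := exists_unsat_circuit
  -- Besides `V`, the hardwired circuit has `2 ^ (w + 1) + n + 2 ^ w` inputs and gates, at most `4 *
  -- 2 ^ w`.
  refine ⟨K + 4, fun n l s t hn hln hs R hR ⟨f, hf, hf'⟩ => ?_⟩
  have hn2 := Nat.lt_size_self n
  obtain ⟨V, hV, hV'⟩ := hK n (Nat.size n) (Nat.size_pos.2 hn) rfl
  refine ⟨fun x => f (R.eval ((hardwired (Nat.size n) l x V).desc s)),
    hf.comp (R.hasCost_eval.comp (hasCost_desc_hardwired _ _ _ V)), fun x => ?_⟩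
  have hsize : (hardwired (Nat.size n) l x V).size ≤ s := by
    rw [size_hardwired, pow_succ]
    refine le_trans ?_ hs
    nlinarith [Nat.zero_le (2 ^ Nat.size n * Nat.size n)]
  -- On the refuter's output, acceptance means that `x` is unsatisfiable; disagreement with `SAT`
  -- there makes the output satisfiable exactly when `x` is.
  have := hR _ hsize
  rw [accepts_hardwired_iff (hln.trans hn2.le)] at this
  rw [hf', hV']
  by_cases h : SAT l (R.eval ((hardwired (Nat.size n) l x V).desc s))
  · simp only [h, iff_true, not_forall, Bool.not_eq_true, true_iff] at this ⊢
    exact this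
  · simp only [h, iff_false, not_not, false_iff, not_exists, Bool.not_eq_false] at this ⊢
    exact this

theorem exists_satSize (n : ℕ) : ∃ s, SatSize n s := by
  classical
  obtain ⟨s, hs⟩ := HasCost.exists_of_finite fun x : Fin n → Bool => decide (SAT n x)
  exact ⟨s, _, hs, by simp⟩

theorem SatSize.mono {n s t : ℕ} (h : SatSize n s) (hst : s ≤ t) : SatSize n t :=
  h.imp fun _ h => ⟨h.1.mono hst, h.2⟩

/-- There is no refuter against circuits of a size that suffices for `SAT`. -/
theorem SatSize.not_refutes {n s : ℕ} (h : SatSize n s)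
    (R : BoolCircuit (CoNondetCircuit.descLen n s) n) : ¬ Refutes SAT n s R := by
  intro hR
  obtain ⟨f, hf, hf'⟩ := h
  obtain ⟨C, hC, hC'⟩ := hf.exists_circuit
  -- A deterministic circuit for `SAT` is co-nondeterministic with no nondeterministic inputs, and
  -- it errs nowhere.
  refine hR ⟨0, C⟩ (by simpa [CoNondetCircuit.size] using hC) ?_
  rw [← hf', ← hC']
  have : ∀ (x : Fin n → Bool) (y : Fin 0 → Bool), Fin.append x y = x := fun x y => by
    rw [Subsingleton.elim y Fin.elim0, Fin.append_elim0]; rfl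
  constructor
  · intro h
    have := h Fin.elim0
    simpa [this] using this
  · intro h y
    simpa [this] using h

/-! ### Growth of circuit sizes -/

theorem eventually_mul_rpow_add_le {a b : ℝ} (hab : a < b) (hb : 0 < b) (C D : ℝ) :
    ∀ᶠ n : ℕ in Filter.atTop, C * (n : ℝ) ^ a + D ≤ (n : ℝ) ^ b := by
  -- Replacing `a` by `max a 0` lets one power of `n` dominate the constant `D` too.
  have h : Filter.Tendsto (fun n : ℕ => (n : ℝ) ^ (b - max a 0)) Filter.atTop Filter.atTop :=
    (tendsto_rpow_atTop (sub_pos.2 (max_lt hab hb))).comp tendsto_natCast_atTop_atTop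
  filter_upwards [h.eventually_ge_atTop (|C| + |D|), Filter.eventually_ge_atTop 1] with n hn h1
  have h1' : (1 : ℝ) ≤ n := by exact_mod_cast h1
  have e1 : (n : ℝ) ^ a ≤ (n : ℝ) ^ max a 0 := Real.rpow_le_rpow_of_exponent_le h1' (le_max_left _ _)
  have e2 : 1 ≤ (n : ℝ) ^ max a 0 := Real.one_le_rpow h1' (le_max_right _ _)
  have e3 : (n : ℝ) ^ b = (n : ℝ) ^ (b - max a 0) * (n : ℝ) ^ max a 0 := by
    rw [← Real.rpow_add (by linarith)]; simp
  have e4 : C * (n : ℝ) ^ a ≤ |C| * (n : ℝ) ^ max a 0 :=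
    mul_le_mul (le_abs_self C) e1 (by positivity) (abs_nonneg C)
  have e5 : D ≤ |D| * (n : ℝ) ^ max a 0 := by
    nlinarith [le_abs_self D, abs_nonneg D]
  rw [e3]
  nlinarith

theorem two_pow_size_le {n : ℕ} (hn : 1 ≤ n) : 2 ^ Nat.size n ≤ 2 * n := by
  obtain ⟨w, hw⟩ := Nat.exists_eq_add_of_le' (Nat.size_pos.2 hn)
  have : 2 ^ w ≤ n := Nat.lt_size.1 (by omega)
  rw [hw, pow_succ]
  omega

theorem size_mul_log_two_le {n : ℕ} (hn : 1 ≤ n) :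
    (Nat.size n : ℝ) * Real.log 2 ≤ Real.log n + Real.log 2 := by
  have h : ((2 ^ Nat.size n : ℕ) : ℝ) ≤ ((2 * n : ℕ) : ℝ) := by exact_mod_cast two_pow_size_le hn
  have := Real.log_le_log (by positivity) h
  push_cast at this
  rw [Real.log_pow, Real.log_mul (by norm_num) (by positivity)] at this
  linarith

/-- `2 ^ Nat.size n` is at most `2 * n`, and `Nat.size n` is logarithmic, hence below a constant
times `n ^ ε`. The extra `1` compensates for rounding the size bound `n ^ k` down. -/
theorem eventually_quasilinear_le {b : ℝ} (hb : 1 < b) (K : ℕ) :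
    ∀ᶠ n : ℕ in Filter.atTop,
      ((K * 2 ^ Nat.size n * (Nat.size n + 1) : ℕ) : ℝ) + 1 ≤ (n : ℝ) ^ b := by
  set ε : ℝ := (b - 1) / 2 with hε
  have hε0 : 0 < ε := by linarith
  have hlog : 0 < Real.log 2 := Real.log_pos (by norm_num)
  filter_upwards [eventually_mul_rpow_add_le (a := 1 + ε) (b := b) (by linarith) (by linarith)
    (K * 2 * (1 / (ε * Real.log 2) + 2)) 1, Filter.eventually_ge_atTop 1] with n hn h1
  refine le_trans ?_ hn
  have h1' : (1 : ℝ) ≤ n := by exact_mod_cast h1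
  have e1 : ((2 : ℝ) ^ Nat.size n) ≤ 2 * n := by exact_mod_cast two_pow_size_le h1
  have e2 : (Nat.size n : ℝ) ≤ (n : ℝ) ^ ε / (ε * Real.log 2) + 1 := by
    have h3 := Real.log_le_rpow_div (x := n) (by linarith) hε0
    have h4 := size_mul_log_two_le h1
    have h5 : (Nat.size n : ℝ) * Real.log 2 ≤ (n : ℝ) ^ ε / ε + Real.log 2 := by linarith
    have h6 := div_le_div_of_nonneg_right h5 hlog.le
    rw [mul_div_cancel_right₀ _ hlog.ne', add_div, div_self hlog.ne', div_div] at h6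
    exact h6
  have e3 : 1 ≤ (n : ℝ) ^ ε := Real.one_le_rpow h1' hε0.le
  have e4 : (Nat.size n : ℝ) + 1 ≤ (1 / (ε * Real.log 2) + 2) * (n : ℝ) ^ ε := by
    have : (n : ℝ) ^ ε / (ε * Real.log 2) = 1 / (ε * Real.log 2) * (n : ℝ) ^ ε := by ring
    linarith
  rw [Real.rpow_add (by linarith), Real.rpow_one]
  push_cast
  have e5 : (2 : ℝ) ^ Nat.size n * ((Nat.size n : ℝ) + 1) ≤
      2 * n * ((1 / (ε * Real.log 2) + 2) * (n : ℝ) ^ ε) :=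
    mul_le_mul e1 e4 (by positivity) (by positivity)
  have := mul_le_mul_of_nonneg_left e5 (Nat.cast_nonneg (α := ℝ) K)
  nlinarith

/-- Refuters with at most `n ^ c` gates against size `n ^ k` give circuits for `SAT` with about
`n ^ (α * c)` gates, where `α` can be any exponent above `1 / k`. -/
theorem exists_satSize_le {k α c κ : ℝ} (hα1 : α < 1) (hk : 0 < k) (hα : 1 < α * k) (hc : 0 ≤ c)
    (hκ : α * c < κ) (s : ℕ → ℕ) (hs : ∀ n : ℕ, (n : ℝ) ^ k < s n + 1)
    (R : ∀ n, BoolCircuit (CoNondetCircuit.descLen n (s n)) n)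
    (hR : ∀ᶠ n : ℕ in Filter.atTop, ((R n).size : ℝ) ≤ (n : ℝ) ^ c ∧ Refutes SAT n (s n) (R n)) :
    ∃ B : ℝ, ∀ n : ℕ, ∃ t : ℕ, (t : ℝ) ≤ B + 2 * (n : ℝ) ^ κ ∧ SatSize n t := by
  have hα0 : 0 < α := by
    by_contra h
    nlinarith
  have hκ0 : 0 < κ := lt_of_le_of_lt (by positivity) hκ
  obtain ⟨K, hK⟩ := exists_satSize_of_refutes
  have hl : Filter.Tendsto (fun n : ℕ => ⌈(n : ℝ) ^ α⌉₊) Filter.atTop Filter.atTop :=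
    tendsto_nat_ceil_atTop.comp
      ((tendsto_rpow_atTop hα0).comp tendsto_natCast_atTop_atTop)
  obtain ⟨N, hN⟩ := Filter.eventually_atTop.1 ((hl.eventually hR).and
    ((eventually_quasilinear_le hα K).and
    ((eventually_mul_rpow_add_le hκ hκ0 (2 ^ c) 2).and
    ((eventually_mul_rpow_add_le (a := α * κ) (b := κ) (by nlinarith) hκ0 (2 * 2 ^ κ) 0).and
    ((eventually_mul_rpow_add_le (a := α) (b := 1) hα1 one_pos 1 1).and
      (Filter.eventually_ge_atTop 1))))))
  choose t ht using exists_satSize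
  -- Arbitrary circuits serve below the threshold `N`; their total size bounds each of them and is
  -- carried unchanged through the recursion.
  refine ⟨∑ i ∈ Finset.range N, (t i : ℝ), fun n => ?_⟩
  induction n using Nat.strong_induction_on with
  | _ n ih =>
  rcases lt_or_ge n N with hn | hn
  · refine ⟨t n, ?_, ht n⟩
    have := Finset.single_le_sum (f := fun i => (t i : ℝ)) (fun i _ => Nat.cast_nonneg _)
      (Finset.mem_range.2 hn)
    have h2 : 0 ≤ (n : ℝ) ^ κ := by positivity
    linarith
  · obtain ⟨⟨hsize, href⟩, hquasi, hcκ, hακ, hlt, h1⟩ := hN n hn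
    set l := ⌈(n : ℝ) ^ α⌉₊ with hldef
    have h1' : (1 : ℝ) ≤ n := by exact_mod_cast h1
    have hl1 : (n : ℝ) ^ α ≤ l := Nat.le_ceil _
    have hl2 : (l : ℝ) < (n : ℝ) ^ α + 1 := Nat.ceil_lt_add_one (by positivity)
    have hl3 : (l : ℝ) ≤ 2 * (n : ℝ) ^ α := by
      have := Real.one_le_rpow h1' hα0.le
      linarith
    have hln : l < n := by
      rw [Real.rpow_one, one_mul] at hlt
      exact_mod_cast hl2.trans_le hlt
    have hpow : ∀ e : ℝ, 0 ≤ e → (l : ℝ) ^ e ≤ 2 ^ e * (n : ℝ) ^ (α * e) := by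
      intro e he
      rw [Real.rpow_mul (by linarith), ← Real.mul_rpow (by norm_num) (by positivity)]
      exact Real.rpow_le_rpow (by positivity) hl3 he
    obtain ⟨t', ht', hsat⟩ := ih l hln
    refine ⟨2 + (R l).size + t', ?_, hK n l (s l) t' h1 hln.le ?_ (R l) href hsat⟩
    -- The recursion closes because `2 + l ^ c` and `2 * l ^ κ` are each at most `n ^ κ`, by `α * c
    -- < κ` and `α * κ < κ`.
    · have h3 := hpow c hc
      have h4 := hpow κ hκ0.le
      push_cast
      linarith
    -- The size allowed on length `l` is about `l ^ k ≥ n ^ (α * k)`, which exceeds the quasilinear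
    -- size of the hardwired circuit as `α * k > 1`.
    · have h3 : (n : ℝ) ^ (α * k) ≤ (l : ℝ) ^ k := by
        rw [Real.rpow_mul (by linarith)]
        exact Real.rpow_le_rpow (by positivity) hl1 hk.le
      have h4 := hs l
      have : ((K * 2 ^ Nat.size n * (Nat.size n + 1) : ℕ) : ℝ) < s l := by linarith
      exact_mod_cast this.le

theorem theorem2 :
    (∀ k c : ℚ, 1 < k → k < c → c < k ^ 2 →
      ¬ ∃ R : ∀ n : ℕ, BoolCircuit (CoNondetCircuit.descLen n ⌊(n : ℝ) ^ (k : ℝ)⌋₊) n,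
        ∀ᶠ n : ℕ in Filter.atTop,
          ((R n).size : ℝ) ≤ (n : ℝ) ^ (c : ℝ) ∧ Refutes SAT n ⌊(n : ℝ) ^ (k : ℝ)⌋₊ (R n)) ∧
    (∃ k : ℕ, 1 ≤ k ∧
      ¬ ∃ R : ∀ n : ℕ, BoolCircuit (CoNondetCircuit.descLen n (n ^ k)) n,
        (∃ d : ℕ, ∀ᶠ n : ℕ in Filter.atTop, (R n).size ≤ n ^ d) ∧
          ∀ᶠ n : ℕ in Filter.atTop, Refutes SAT n (n ^ k) (R n)) := by
  refine ⟨?_, ?_⟩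
  · rintro k c hk hkc hck ⟨R, hR⟩
    have hk' : (1 : ℝ) < k := by exact_mod_cast hk
    have hkc' : (k : ℝ) < c := by exact_mod_cast hkc
    have hck' : (c : ℝ) < (k : ℝ) ^ 2 := by exact_mod_cast hck
    -- The interval is nonempty exactly because `c < k ^ 2`. Its lower end leaves room for the
    -- hardwired circuit, its upper end makes the circuits for `SAT` smaller than `n ^ k`; `k < c`
    -- yields `α < 1`.
    obtain ⟨α, h1, h2⟩ : ∃ α : ℝ, 1 / (k : ℝ) < α ∧ α < k / c := by
      refine exists_between ?_
      rw [div_lt_div_iff₀ (by linarith) (by linarith)]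
      nlinarith
    have hα : 1 < α * k := by rwa [div_lt_iff₀ (by linarith)] at h1
    have hαc : α * c < k := by rwa [lt_div_iff₀ (by linarith)] at h2
    have hα1 : α < 1 := h2.trans ((div_lt_one (by linarith)).2 hkc')
    obtain ⟨κ, hκ1, hκ2⟩ := exists_between hαc
    obtain ⟨B, hB⟩ := exists_satSize_le hα1 (by linarith) hα (by linarith) hκ1 _
      (fun n => Nat.lt_floor_add_one _) R hR
    obtain ⟨n, hn, hn'⟩ := ((eventually_mul_rpow_add_le hκ2 (by linarith) 2 B).and hR).exists
    obtain ⟨t, ht, hsat⟩ := hB n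
    exact (hsat.mono (Nat.le_floor (by linarith))).not_refutes (R n) hn'.2
  -- Either `k = 2` already works, or a polynomial refuter against size `n ^ 2` supplies the
  -- exponent `d` from which `k` is chosen.
  · by_cases h : ∃ R : ∀ n : ℕ, BoolCircuit (CoNondetCircuit.descLen n (n ^ 2)) n,
        (∃ d : ℕ, ∀ᶠ n : ℕ in Filter.atTop, (R n).size ≤ n ^ d) ∧
          ∀ᶠ n : ℕ in Filter.atTop, Refutes SAT n (n ^ 2) (R n)
    swap
    · exact ⟨2, by norm_num, h⟩
    obtain ⟨R, ⟨d, hd⟩, hR⟩ := h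
    -- Any `α` strictly between `1 / 2` and `1` would do; `κ = d + 1` exceeds `α * d`.
    obtain ⟨B, hB⟩ := exists_satSize_le (k := 2) (α := 3 / 4) (c := d) (κ := d + 1) (by norm_num)
      (by norm_num) (by norm_num) (by positivity) (by
        have : (0 : ℝ) ≤ d := by positivity
        linarith) (fun n => n ^ 2) (fun n => by norm_num) R (by
        filter_upwards [hd, hR] with n h1 h2
        refine ⟨?_, h2⟩
        rw [Real.rpow_natCast]
        exact_mod_cast h1)
    -- `SAT` has circuits of size `B + 2 * n ^ (d + 1)`, eventually at most `n ^ (d + 2)`, so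
    -- against this size no refuter of whatever size succeeds on all large lengths.
    refine ⟨d + 2, by omega, ?_⟩
    rintro ⟨R', -, hR'⟩
    obtain ⟨n, hn, hn'⟩ := ((eventually_mul_rpow_add_le (a := d + 1) (b := (d + 2 : ℕ))
      (by push_cast; linarith) (by positivity) 2 B).and hR').exists
    obtain ⟨t, ht, hsat⟩ := hB n
    refine (hsat.mono ?_).not_refutes (R' n) hn'
    rw [Real.rpow_natCast] at hn
    have : (t : ℝ) ≤ (n : ℝ) ^ (d + 2) := by linarith
    exact_mod_cast this
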